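/- **Setting.** A tensor $A\in(\mathbb R^N)^{\otimes p}$ acts by $A(u)=\sum_{i_1,\dots,i_p}A_{i_1\dots i_p}u_{i_1}\cdots u_{i_p}$, and $A(\cdot,u)\in\mathbb R^N$ is the vector with entries $A(\cdot,u)_j=\sum_{i_1,\dots,i_{p-1}}A_{j,i_1\dots i_{p-1}}u_{i_1}\cdots u_{i_{p-1}}$. Let $\mathcal B_N=\{-1,1\}^N$ and $\mathcal H_N=[-1,1]^N$. Throughout, $A$ and $\hat A$ are independent random tensors with i.i.d. $\mathcal N(0,N^{-(p-1)})$ entries, $\eta_N=\frac1N\min_{\sigma\in\mathcal B_N}A(\sigma)$, and $A_\tau=\sqrt{1-\tau}\,A+\sqrt{\tau}\,\hat A$ for $\tau\in[0,1]$. For $x\in\mathbb R$ and $M>0$ put $[x]_M=\max(-M,\min(x,M))$, applied coordinatewise to vectors. **OGP.** A set $\mathcal A$ of tensors satisfies the overlap gap property (OGP) with domain $\mathcal S\subset\mathbb R^N$ and parameters $\mu,\nu_1,\nu_2$ if for all $A_1,A_2\in\mathcal A$ and all $u_1,u_2\in\mathcal S$ with $\frac1NA_j(u_j)\le\frac1N\inf_{w\in\mathcal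 S}A_j(w)+\mu$ $(j=1,2)$ one has $\frac{|\langle u_1,u_2\rangle|}{\|u_1\|_2\|u_2\|_2}\in[0,\nu_1]\cup[\nu_2,1]$ (the quotient being read as $0$ if $u_1=0$ or $u_2=0$). **Conjecture (for a given $p$).** (i) There are $\mu>0$, $0<\nu_1<\nu_2<1$ and $c>0$ such that for all sufficiently large $N$, with probability at least $1-e^{-cN}$, the family $\{A_\tau:0\le\tau\le1\}$ satisfies the OGP with domain $\mathcal H_N$ and parameters $\mu,\nu_1,\nu_2$. (ii) For every $\varepsilon>0$ there are $\delta>0$ and $c>0$ such that for all sufficiently large $N$, with probability at least $1-e^{-cN}$: every $v_1,v_2\in\mathcal H_N$ with $A(v_1)/N\le(1-\delta)\mathbb E\eta_N$ and $\hat A(v_2)/N\le(1-\delta)\mathbb E\eta_N$ satisfy $|\langle v_1,v_2\rangle|\le\varepsilon N$. **AMP.** Let $T\ge1$ be an integer, $M\geq 1$ and $\zeta>0$. For $1\le t\le T$ let $f_t:[-M,M]^t\to\mathbb R$ and $F_t:\mathbb R\times[-M,M]^t\to\mathbb R$ be $\zeta$-Lipschitz with respect to the Euclidean norm, with $f_t(0)=0$.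 Given $U^0\in[-M,M]^N$, define for $1\le t\le T$ $$U^t=\big[F_t\big(A(\cdot,f_t(U^0,\dots,U^{t-1})),U^0,\dots,U^{t-1}\big)\big]_M,$$ with $f_t,F_t$ applied coordinatewise, and let $V=V(A,T,U^0)=[U^T]_1\in\mathcal H_N$. **Theorem.** Let $p\ge4$ be even, and let $M\ge1$, $\zeta>0$, $T\geq 1$ and $(f_t),(F_t)$ be as above. Assume the Conjecture for this $p$. Then there exist $\bar\mu>0$, $c>0$ and $N_0$ such that for every $N\ge N_0$ and every probability measure $\nu$ on $[-M,M]^N$, if $U^0\sim\nu$ is independent of $A$, then $$\mathbb P\left(\frac{A(V)}{N}\ge\frac{\min_{\sigma\in\mathcal B_N}A(\sigma)}{N}+\bar\mu\right)\ge1-e^{-cN}.$$ -/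

import Mathlib

open MeasureTheory ProbabilityTheory Filter
open scoped NNReal

noncomputable section

namespace PSpin

/-- Real `N`-tensors of order `p`. -/
abbrev Tensor (p N : ℕ) : Type := (Fin p → Fin N) → ℝ

/-- `A(u) = ∑_{i₁,…,i_p} A_{i₁,…,i_p} u_{i₁} ⋯ u_{i_p}`. -/
def eval {p N : ℕ} (A : Tensor p N) (u : Fin N → ℝ) : ℝ :=
  ∑ i : Fin p → Fin N, A i * ∏ k, u (i k)

/-- The vector `A(·,u)` with entries
`A(·,u)_j = ∑_{i₁,…,i_{p-1}} A_{j,i₁,…,i_{p-1}} u_{i₁} ⋯ u_{i_{p-1}}` (for `p ≥ 1`). -/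
def marginal {p N : ℕ} (A : Tensor p N) (u : Fin N → ℝ) : Fin N → ℝ := fun j =>
  ∑ i : Fin (p - 1) → Fin N,
    A (fun k => if h : (k : ℕ) = 0 then j else i ⟨(k : ℕ) - 1, by omega⟩) * ∏ l, u (i l)

/-- The law of a tensor with i.i.d. centered Gaussian entries of variance `1 / N ^ (p - 1)`. -/
def couplingLaw (p N : ℕ) : Measure (Tensor p N) :=
  Measure.pi fun _ => gaussianReal 0 (1 / (N : ℝ≥0) ^ (p - 1))

/-- The binary cube `{-1, 1}^N`. -/
def binaryCube (N : ℕ) : Set (Fin N → ℝ) := {σ | ∀ i, σ i = -1 ∨ σ i = 1}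

/-- The cube `[-1, 1]^N`. -/
def hilbertCube (N : ℕ) : Set (Fin N → ℝ) := {u | ∀ i, u i ∈ Set.Icc (-1) 1}

/-- The infimum of `A` over a set `S` of vectors. -/
def infOn {p N : ℕ} (A : Tensor p N) (S : Set (Fin N → ℝ)) : ℝ := sInf (eval A '' S)

/-- The normalized ground state value `η_N = N⁻¹ min_{σ ∈ {-1,1}^N} A(σ)`. -/
def groundState {p N : ℕ} (A : Tensor p N) : ℝ := infOn A (binaryCube N) / N

/-- The expectation of `η_N`. -/
def meanGroundState (p N : ℕ) : ℝ := ∫ A, groundState A ∂(couplingLaw p N)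

/-- The standard inner product. -/
def inner {N : ℕ} (u v : Fin N → ℝ) : ℝ := ∑ i, u i * v i

/-- The Euclidean norm. -/
def norm2 {N : ℕ} (u : Fin N → ℝ) : ℝ := √(∑ i, u i ^ 2)

/-- The set `𝒜` of tensors has the overlap gap property with domain `S` and parameters
`μ, ν₁, ν₂`. -/
def OverlapGapProperty {p N : ℕ} (𝒜 : Set (Tensor p N)) (S : Set (Fin N → ℝ))
    (μ ν₁ ν₂ : ℝ) : Prop :=
  ∀ A₁ ∈ 𝒜, ∀ A₂ ∈ 𝒜, ∀ u₁ ∈ S, ∀ u₂ ∈ S,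
    eval A₁ u₁ / N ≤ infOn A₁ S / N + μ → eval A₂ u₂ / N ≤ infOn A₂ S / N + μ →
      |inner u₁ u₂| / (norm2 u₁ * norm2 u₂) ∈ Set.Icc 0 ν₁ ∪ Set.Icc ν₂ 1

/-- The interpolated tensors `A_τ = √(1-τ) A + √τ Â`, `0 ≤ τ ≤ 1`. -/
def interpolation {p N : ℕ} (A A' : Tensor p N) : Set (Tensor p N) :=
  {B | ∃ τ ∈ Set.Icc (0 : ℝ) 1, B = √(1 - τ) • A + √τ • A'}

/-- The conjecture for tensors of order `p`: with overwhelming probability the interpolated family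
of two independent tensors has the overlap gap property on `[-1,1]^N`, and near optimizers of two
independent tensors are nearly orthogonal. -/
def OGPConjecture (p : ℕ) : Prop :=
  (∃ μ ν₁ ν₂ : ℝ, 0 < μ ∧ 0 < ν₁ ∧ ν₁ < ν₂ ∧ ν₂ < 1 ∧
    ∃ c : ℝ, 0 < c ∧ ∀ᶠ N : ℕ in atTop,
      1 - Real.exp (-c * N) ≤ ((couplingLaw p N).prod (couplingLaw p N)).real
        {AA | OverlapGapProperty (interpolation AA.1 AA.2) (hilbertCube N) μ ν₁ ν₂}) ∧
  (∀ ε : ℝ, 0 < ε → ∃ δ : ℝ, 0 < δ ∧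
    ∃ c : ℝ, 0 < c ∧ ∀ᶠ N : ℕ in atTop,
      1 - Real.exp (-c * N) ≤ ((couplingLaw p N).prod (couplingLaw p N)).real
        {AA | ∀ v₁ ∈ hilbertCube N, ∀ v₂ ∈ hilbertCube N,
          eval AA.1 v₁ / N ≤ (1 - δ) * meanGroundState p N →
          eval AA.2 v₂ / N ≤ (1 - δ) * meanGroundState p N →
            |inner v₁ v₂| ≤ ε * N})

/-- The `M`-truncation `[x]_M = max(-M, min(x, M))`. -/
def trunc (M x : ℝ) : ℝ := max (-M) (min x M)

/-- The box `[-M, M]^t`. -/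
def box (M : ℝ) (t : ℕ) : Set (Fin t → ℝ) := {u | ∀ s, u s ∈ Set.Icc (-M) M}

/-- The assumption on the functions `f_t : [-M,M]^t → ℝ` and `F_t : ℝ × [-M,M]^t → ℝ`,
`1 ≤ t ≤ T`; values outside these domains and for other `t` are unconstrained. -/
def AMPAssumption (M ζ : ℝ) (T : ℕ) (f : (t : ℕ) → (Fin t → ℝ) → ℝ)
    (F : (t : ℕ) → ℝ → (Fin t → ℝ) → ℝ) : Prop :=
  ∀ t, 1 ≤ t → t ≤ T →
    f t 0 = 0 ∧
    (∀ u ∈ box M t, ∀ v ∈ box M t, |f t u - f t v| ≤ ζ * norm2 (u - v)) ∧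
    (∀ x y : ℝ, ∀ u ∈ box M t, ∀ v ∈ box M t,
      |F t x u - F t y v| ≤ ζ * √((x - y) ^ 2 + ∑ s, (u s - v s) ^ 2))

/-- The iterates `U^0 = U0`,
`U^t = [F_t(A(·, f_t(U^0,…,U^{t-1})), U^0,…,U^{t-1})]_M`, with `f_t`, `F_t` and the truncation
applied coordinatewise. -/
def ampIterate {p N : ℕ} (M : ℝ) (f : (t : ℕ) → (Fin t → ℝ) → ℝ)
    (F : (t : ℕ) → ℝ → (Fin t → ℝ) → ℝ) (A : Tensor p N) (U0 : Fin N → ℝ) :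
    ℕ → Fin N → ℝ
  | 0 => U0
  | t + 1 => fun j =>
      trunc M (F (t + 1)
        (marginal A
          (fun i => f (t + 1) (fun s : Fin (t + 1) => ampIterate M f F A U0 s.val i)) j)
        (fun s : Fin (t + 1) => ampIterate M f F A U0 s.val j))
  termination_by t => t
  decreasing_by all_goals exact s.isLt

/-- The output `V(A, T, U0) = [U^T]_1 ∈ [-1,1]^N`. -/
def ampOutput {p N : ℕ} (M : ℝ) (f : (t : ℕ) → (Fin t → ℝ) → ℝ)
    (F : (t : ℕ) → ℝ → (Fin t → ℝ) → ℝ) (T : ℕ) (A : Tensor p N) (U0 : Fin N → ℝ) :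
    Fin N → ℝ :=
  fun j => trunc 1 (ampIterate M f F A U0 T j)

end PSpin

end

namespace PSpin

open scoped ENNReal Pointwise

/-! ### One-dimensional Brunn–Minkowski and Prékopa–Leindler inequalities -/

/-! The overlap gap obstructs algorithms whose output `V(A)` depends on `A` in a Lipschitz way. Fix
the start `U0`, and suppose that `V(A)` is near optimal with probability at least about `e^{-cN}`.

Gaussian isoperimetry (`couplingLaw_far_mul_le`) says that all but an exponentially small fraction
of tensors lie close to such a success. Since `V` is Lipschitz where the injective norm is bounded
(`exists_rms_ampOutput_sub_le`), near optimality, with a slightly larger error, then holds with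
probability close to 1 (`couplingLaw_not_near_optimal_le`). The rotations `cos θ A + sin θ A'` all
have the law of one tensor, so a union bound gives near optimality at all points of a fixed finite
grid of angles from `A` to `A'`. Consecutive outputs are close, so their overlap with the first
output changes in steps smaller than the gap: it starts at 1 and can never cross the gap. But the
last output is near optimal for the independent tensor `A'`, so part (ii) of the conjecture makes it
nearly orthogonal to the first. This contradiction is `OverlapGapProperty.false_of_path`.

Three facts complete the argument. Concentration comes from a one-dimensional Prékopa–Leindler
inequality that tensorizes. The minima over the solid and the binary cube agree up to `εN`
(`eventually_infOn_binaryCube_le`), since averaging over independent signs changes only the terms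
with repeated indices. The mean ground state is bounded away from 0
(`eventually_meanGroundState_le`), which bounds the norms of near optimizers from below. The
estimate is uniform in `U0`, so a random start is handled by Fubini. -/

theorem volume_add_le_of_isCompact {K L C : Set ℝ} (hK : IsCompact K) (hL : IsCompact L)
    (hK0 : K.Nonempty) (hL0 : L.Nonempty) (h : ∀ a ∈ K, ∀ b ∈ L, a + b ∈ C) :
    volume K + volume L ≤ volume C := by
  have ha := hK.sSup_mem hK0
  have hb := hL.sInf_mem hL0
  -- The translates of `K` by `min L` and of `L` by `max K` both lie in the sumset and share only
  -- the point `max K + min L`.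
  set a := sSup K
  set b := sInf L
  have h1 : volume ((fun x => b + x) '' K) = volume K := by
    rw [Set.image_add_left, measure_preimage_add]
  have h2 : volume ((fun x => a + x) '' L) = volume L := by
    rw [Set.image_add_left, measure_preimage_add]
  rw [← h1, ← h2, ← measure_union₀]
  · apply measure_mono
    rintro x (⟨k, hk, rfl⟩ | ⟨l, hl, rfl⟩)
    · simpa [add_comm] using h k hk b hb
    · exact h a ha l hl
  · exact (hL.image (continuous_const_add a)).measurableSet.nullMeasurableSet
  · refine measure_mono_null (t := {a + b}) ?_ (by simp)
    rintro x ⟨⟨k, hk, rfl⟩, ⟨l, hl, hx⟩⟩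
    have h3 : k ≤ a := le_csSup hK.bddAbove hk
    have h4 : b ≤ l := csInf_le hL.bddBelow hl
    simp only at hx
    simp only [Set.mem_singleton_iff]
    linarith

theorem volume_add_le {A B C : Set ℝ} (hA : MeasurableSet A) (hB : MeasurableSet B)
    (hA0 : A.Nonempty) (hB0 : B.Nonempty) (h : ∀ a ∈ A, ∀ b ∈ B, a + b ∈ C) :
    volume A + volume B ≤ volume C := by
  rw [hA.measure_eq_iSup_isCompact, hB.measure_eq_iSup_isCompact]
  obtain ⟨a, ha⟩ := hA0
  obtain ⟨b, hb⟩ := hB0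
  simp only [iSup_and']
  refine ENNReal.biSup_add_biSup_le' ⟨∅, by simp, by simp⟩ ⟨∅, by simp, by simp⟩ ?_
  rintro K ⟨hKA, hK⟩ L ⟨hLB, hL⟩
  -- The approximating compact sets may be empty; adjoining a point of `A` and of `B` makes the
  -- compact case applicable.
  refine le_trans (add_le_add (measure_mono (Set.subset_insert a K))
    (measure_mono (Set.subset_insert b L))) ?_
  refine volume_add_le_of_isCompact (hK.insert a) (hL.insert b) (Set.insert_nonempty _ _)
    (Set.insert_nonempty _ _) fun x hx y hy => h x ?_ y ?_
  · exact Set.insert_subset ha hKA hx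
  · exact Set.insert_subset hb hLB hy

/-- Layer-cake form of Prékopa–Leindler. If `f a > t` and `g b > t`, then `h > t` at the midpoint,
so Brunn–Minkowski applies to superlevel sets. Both suprema equal 1, hence the two superlevel sets
are nonempty for the same levels `t < 1` and empty beyond. -/
theorem lintegral_add_le_of_mul_le {f g h : ℝ → ℝ} (hf : Measurable f) (hg : Measurable g)
    (hh : Measurable h) (hf0 : ∀ x, 0 ≤ f x) (hg0 : ∀ x, 0 ≤ g x) (hh0 : ∀ x, 0 ≤ h x)
    (hf1 : IsLUB (Set.range f) 1) (hg1 : IsLUB (Set.range g) 1)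
    (H : ∀ x y, f x * g y ≤ h ((x + y) / 2) ^ 2) :
    (∫⁻ x, ENNReal.ofReal (f x)) + ∫⁻ x, ENNReal.ofReal (g x) ≤
      2 * ∫⁻ x, ENNReal.ofReal (h x) := by
  rw [lintegral_eq_lintegral_meas_lt _ (ae_of_all _ hf0) hf.aemeasurable,
    lintegral_eq_lintegral_meas_lt _ (ae_of_all _ hg0) hg.aemeasurable,
    lintegral_eq_lintegral_meas_lt _ (ae_of_all _ hh0) hh.aemeasurable,
    ← lintegral_const_mul' _ _ (by simp), ← lintegral_add_left']
  swap
  · refine (Antitone.measurable ?_).aemeasurable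
    intro s t hst
    exact measure_mono fun x hx => lt_of_le_of_lt hst hx
  refine setLIntegral_mono' measurableSet_Ioi fun t ht => ?_
  rcases lt_or_ge t 1 with ht1 | ht1
  · have hA : {x | t < f x}.Nonempty := by
      obtain ⟨_, ⟨x, rfl⟩, hx⟩ := (lt_isLUB_iff hf1).1 ht1
      exact ⟨x, hx⟩
    have hB : {x | t < g x}.Nonempty := by
      obtain ⟨_, ⟨x, rfl⟩, hx⟩ := (lt_isLUB_iff hg1).1 ht1
      exact ⟨x, hx⟩
    have h2 : 2 * volume {x | t < h x} = volume ((fun x => (2⁻¹ : ℝ) * x) ⁻¹' {x | t < h x}) := by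
      rw [Real.volume_preimage_mul_left (by norm_num)]
      norm_num
    rw [h2]
    refine volume_add_le (measurableSet_lt measurable_const hf)
      (measurableSet_lt measurable_const hg) hA hB fun a ha b hb => ?_
    simp only [Set.mem_ofPred_eq, Set.mem_preimage, Set.mem_Ioi] at *
    have h3 : t ^ 2 < h ((a + b) / 2) ^ 2 := by
      refine lt_of_lt_of_le ?_ (H a b)
      nlinarith
    have := lt_of_pow_lt_pow_left₀ 2 (hh0 _) h3
    rwa [show (2⁻¹ : ℝ) * (a + b) = (a + b) / 2 by ring]
  · have hA : {x | t < f x} = ∅ := by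
      ext x
      simpa using (hf1.1 ⟨x, rfl⟩).trans ht1
    have hB : {x | t < g x} = ∅ := by
      ext x
      simpa using (hg1.1 ⟨x, rfl⟩).trans ht1
    simp [hA, hB]

theorem ennreal_mul_le_one_of_add_le_two {a b : ℝ≥0∞} (h : a + b ≤ 2) : a * b ≤ 1 := by
  have ha : a ≠ ∞ := by rintro rfl; simp at h
  have hb : b ≠ ∞ := by rintro rfl; simp at h
  lift a to ℝ≥0 using ha
  lift b to ℝ≥0 using hb
  norm_cast at *
  have h' : (a : ℝ) + b ≤ 2 := by exact_mod_cast h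
  have : (a : ℝ) * b ≤ 1 := by nlinarith [sq_nonneg ((a : ℝ) - b), a.2, b.2]
  exact_mod_cast this

/-- Dividing `f`, `g`, `h` by `a`, `b`, `√(ab)`, with `a` and `b` the suprema of `f` and `g`,
preserves the hypothesis and reduces to the additive inequality; the arithmetic-geometric mean
inequality then recovers the product. -/
theorem lintegral_mul_lintegral_le_of_bounded {f g h : ℝ → ℝ} (hf : Measurable f)
    (hg : Measurable g) (hh : Measurable h) (hf0 : ∀ x, 0 ≤ f x) (hg0 : ∀ x, 0 ≤ g x)
    (hh0 : ∀ x, 0 ≤ h x) (hfb : BddAbove (Set.range f)) (hgb : BddAbove (Set.range g))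
    (H : ∀ x y, f x * g y ≤ h ((x + y) / 2) ^ 2)
    (h1 : ∫⁻ x, ENNReal.ofReal (h x) = 1) :
    (∫⁻ x, ENNReal.ofReal (f x)) * ∫⁻ x, ENNReal.ofReal (g x) ≤ 1 := by
  have hfL := isLUB_csSup (Set.range_nonempty f) hfb
  have hgL := isLUB_csSup (Set.range_nonempty g) hgb
  set a := sSup (Set.range f)
  set b := sSup (Set.range g)
  have ha0 : 0 ≤ a := (hf0 0).trans (hfL.1 ⟨0, rfl⟩)
  have hb0 : 0 ≤ b := (hg0 0).trans (hgL.1 ⟨0, rfl⟩)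
  rcases ha0.eq_or_lt with ha | ha
  · have : ∀ x, f x = 0 := fun x => le_antisymm (ha ▸ hfL.1 ⟨x, rfl⟩) (hf0 x)
    simp [this]
  rcases hb0.eq_or_lt with hb | hb
  · have : ∀ x, g x = 0 := fun x => le_antisymm (hb ▸ hgL.1 ⟨x, rfl⟩) (hg0 x)
    simp [this]
  have key : ∀ {f : ℝ → ℝ} {a : ℝ}, 0 < a → IsLUB (Set.range f) a →
      IsLUB (Set.range fun x => a⁻¹ * f x) 1 := by
    intro f a ha hL
    constructor
    · rintro _ ⟨x, rfl⟩
      have := hL.1 ⟨x, rfl⟩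
      simp only
      rw [inv_mul_le_iff₀ ha]
      simpa using this
    · intro u hu
      have : a ≤ a * u := hL.2 (by
        rintro _ ⟨x, rfl⟩
        have := hu ⟨x, rfl⟩
        simp only at this
        rwa [inv_mul_le_iff₀ ha] at this)
      nlinarith
  have hs : 0 < √(a * b) := Real.sqrt_pos.2 (mul_pos ha hb)
  have main := lintegral_add_le_of_mul_le (hf.const_mul a⁻¹) (hg.const_mul b⁻¹)
    (hh.const_mul (√(a * b))⁻¹) (fun x => mul_nonneg (inv_nonneg.2 ha.le) (hf0 x))
    (fun x => mul_nonneg (inv_nonneg.2 hb.le) (hg0 x))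
    (fun x => mul_nonneg (inv_nonneg.2 hs.le) (hh0 x)) (key ha hfL) (key hb hgL) (by
      intro x y
      rw [mul_pow, inv_pow, Real.sq_sqrt (by positivity), mul_inv]
      calc a⁻¹ * f x * (b⁻¹ * g y) = a⁻¹ * b⁻¹ * (f x * g y) := by ring
        _ ≤ _ := by gcongr; exact H x y)
  simp_rw [ENNReal.ofReal_mul (inv_nonneg.2 ha.le), ENNReal.ofReal_mul (inv_nonneg.2 hb.le),
    ENNReal.ofReal_mul (inv_nonneg.2 hs.le)] at main
  rw [lintegral_const_mul _ hf.ennreal_ofReal, lintegral_const_mul _ hg.ennreal_ofReal,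
    lintegral_const_mul _ hh.ennreal_ofReal, h1, mul_one] at main
  set I := ∫⁻ x, ENNReal.ofReal (f x)
  set J := ∫⁻ x, ENNReal.ofReal (g x)
  have e : ENNReal.ofReal (√(a * b)) * ENNReal.ofReal (√(a * b))⁻¹ = 1 := by
    rw [← ENNReal.ofReal_mul hs.le, mul_inv_cancel₀ hs.ne', ENNReal.ofReal_one]
  have m2 : ENNReal.ofReal (√(a * b)) * (ENNReal.ofReal a⁻¹ * I) +
      ENNReal.ofReal (√(a * b)) * (ENNReal.ofReal b⁻¹ * J) ≤ 2 := by
    rw [← mul_add]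
    calc _ ≤ ENNReal.ofReal (√(a * b)) * (2 * ENNReal.ofReal (√(a * b))⁻¹) := by gcongr
      _ = 2 * (ENNReal.ofReal (√(a * b)) * ENNReal.ofReal (√(a * b))⁻¹) := by ring
      _ = 2 := by rw [e, mul_one]
  have m3 := ennreal_mul_le_one_of_add_le_two m2
  have e2 : ENNReal.ofReal (√(a * b)) * ENNReal.ofReal a⁻¹ *
      (ENNReal.ofReal (√(a * b)) * ENNReal.ofReal b⁻¹) = 1 := by
    rw [← ENNReal.ofReal_mul hs.le, ← ENNReal.ofReal_mul hs.le,
      ← ENNReal.ofReal_mul (by positivity)]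
    have : √(a * b) * a⁻¹ * (√(a * b) * b⁻¹) = 1 := by
      calc _ = √(a * b) ^ 2 * (a⁻¹ * b⁻¹) := by ring
        _ = 1 := by rw [Real.sq_sqrt (by positivity)]; field_simp
    rw [this, ENNReal.ofReal_one]
  calc I * J = (ENNReal.ofReal (√(a * b)) * ENNReal.ofReal a⁻¹ *
      (ENNReal.ofReal (√(a * b)) * ENNReal.ofReal b⁻¹)) * (I * J) := by rw [e2, one_mul]
    _ = _ := by ring
    _ ≤ 1 := m3

/-! ### Gaussian concentration -/

/-- Prékopa–Leindler with the Gaussian density `φ` absorbed into `f` and `g`: by the parallelogram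
identity `φ(x) φ(y) exp((x-y)²/(4v)) = φ((x+y)/2)²`. Boundedness only makes the suprema finite, and
the next lemma removes it by truncation. -/
theorem lintegral_mul_lintegral_gaussianReal_le_of_bounded {v : ℝ≥0} (hv : v ≠ 0) {f g : ℝ → ℝ}
    (hf : Measurable f) (hg : Measurable g) (hf0 : ∀ x, 0 ≤ f x) (hg0 : ∀ x, 0 ≤ g x)
    {b : ℝ} (hfb : ∀ x, f x ≤ b) (hgb : ∀ x, g x ≤ b)
    (H : ∀ x y, f x * g y ≤ Real.exp ((x - y) ^ 2 / (4 * v))) :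
    (∫⁻ x, ENNReal.ofReal (f x) ∂(gaussianReal 0 v)) *
      ∫⁻ x, ENNReal.ofReal (g x) ∂(gaussianReal 0 v) ≤ 1 := by
  have hv' : (0 : ℝ) < v := by positivity
  have hconv : ∀ {f : ℝ → ℝ}, Measurable f →
      ∫⁻ x, ENNReal.ofReal (f x) ∂(gaussianReal 0 v) =
        ∫⁻ x, ENNReal.ofReal (gaussianPDFReal 0 v x * f x) := by
    intro f hf
    rw [gaussianReal_of_var_ne_zero _ hv,
      lintegral_withDensity_eq_lintegral_mul _ (measurable_gaussianPDF 0 v) hf.ennreal_ofReal]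
    refine lintegral_congr fun x => ?_
    simp [gaussianPDF, ENNReal.ofReal_mul (gaussianPDFReal_nonneg 0 v x)]
  have hbd : ∀ {f : ℝ → ℝ}, (∀ x, 0 ≤ f x) → (∀ x, f x ≤ b) →
      BddAbove (Set.range fun x => gaussianPDFReal 0 v x * f x) := by
    intro f hf0 hfb
    refine ⟨(√(2 * Real.pi * v))⁻¹ * b, ?_⟩
    rintro _ ⟨x, rfl⟩
    have : gaussianPDFReal 0 v x ≤ (√(2 * Real.pi * v))⁻¹ := by
      rw [gaussianPDFReal]
      refine mul_le_of_le_one_right (by positivity) (Real.exp_le_one_iff.2 ?_)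
      rw [neg_div]
      exact neg_nonpos.2 (by positivity)
    exact mul_le_mul this (hfb x) (hf0 x) (by positivity)
  rw [hconv hf, hconv hg]
  refine lintegral_mul_lintegral_le_of_bounded ((measurable_gaussianPDFReal 0 v).mul hf)
    ((measurable_gaussianPDFReal 0 v).mul hg) (measurable_gaussianPDFReal 0 v)
    (fun x => mul_nonneg (gaussianPDFReal_nonneg 0 v x) (hf0 x))
    (fun x => mul_nonneg (gaussianPDFReal_nonneg 0 v x) (hg0 x))
    (gaussianPDFReal_nonneg 0 v) (hbd hf0 hfb) (hbd hg0 hgb) (fun x y => ?_)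
    (lintegral_gaussianPDFReal_eq_one 0 hv)
  calc _ = gaussianPDFReal 0 v x * gaussianPDFReal 0 v y * (f x * g y) := by ring
    _ ≤ gaussianPDFReal 0 v x * gaussianPDFReal 0 v y * Real.exp ((x - y) ^ 2 / (4 * v)) := by
        gcongr
        · exact mul_nonneg (gaussianPDFReal_nonneg 0 v x) (gaussianPDFReal_nonneg 0 v y)
        · exact H x y
    _ = _ := by
        simp only [gaussianPDFReal]
        rw [mul_pow, ← Real.exp_nat_mul]
        rw [show ∀ c e1 e2 e3 : ℝ, c * e1 * (c * e2) * e3 = c ^ 2 * (e1 * e2 * e3) by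
          intros; ring, ← Real.exp_add, ← Real.exp_add]
        congr 2
        field_simp
        push_cast
        ring

theorem lintegral_mul_lintegral_gaussianReal_le {v : ℝ≥0} (hv : v ≠ 0) {f g : ℝ → ℝ≥0∞}
    (hf : Measurable f) (hg : Measurable g)
    (H : ∀ x y, f x * g y ≤ ENNReal.ofReal (Real.exp ((x - y) ^ 2 / (4 * v)))) :
    (∫⁻ x, f x ∂(gaussianReal 0 v)) * ∫⁻ x, g x ∂(gaussianReal 0 v) ≤ 1 := by
  have hsup : ∀ {f : ℝ → ℝ≥0∞}, Measurable f → ∫⁻ x, f x ∂(gaussianReal 0 v) =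
      ⨆ n : ℕ, ∫⁻ x, min (f x) n ∂(gaussianReal 0 v) := by
    intro f hf
    rw [← lintegral_iSup (fun n => hf.min measurable_const)]
    · refine lintegral_congr fun x => ?_
      rw [← inf_iSup_eq, ENNReal.iSup_natCast, inf_top_eq]
    · intro m n hmn x
      exact min_le_min_left _ (by exact_mod_cast hmn)
  rw [hsup hf, hsup hg, ENNReal.iSup_mul]
  refine iSup_le fun m => ?_
  rw [ENNReal.mul_iSup]
  refine iSup_le fun n => ?_
  have hfin : ∀ (a : ℝ≥0∞) (n : ℕ), min a n ≠ ∞ := fun a n =>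
    ne_top_of_le_ne_top (ENNReal.natCast_ne_top n) (min_le_right _ _)
  have e : ∀ (a : ℝ≥0∞) (n : ℕ), min a n = ENNReal.ofReal (min a n).toReal := fun a n =>
    (ENNReal.ofReal_toReal (hfin a n)).symm
  have hb : ∀ (a : ℝ≥0∞) (n : ℕ), (min a n).toReal ≤ n := fun a n => by
    simpa using ENNReal.toReal_mono (ENNReal.natCast_ne_top n) (min_le_right a n)
  rw [lintegral_congr fun x => e (f x) m, lintegral_congr fun x => e (g x) n]
  refine lintegral_mul_lintegral_gaussianReal_le_of_bounded hv
    (hf.min measurable_const).ennreal_toReal (hg.min measurable_const).ennreal_toReal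
    (fun _ => ENNReal.toReal_nonneg) (fun _ => ENNReal.toReal_nonneg) (b := max (m : ℝ) n)
    (fun x => (hb _ _).trans (le_max_left _ _)) (fun x => (hb _ _).trans (le_max_right _ _)) ?_
  intro x y
  rw [← ENNReal.toReal_mul, ← ENNReal.toReal_ofReal (Real.exp_pos ((x - y) ^ 2 / (4 * v))).le]
  refine ENNReal.toReal_mono ENNReal.ofReal_ne_top (le_trans ?_ (H x y))
  gcongr <;> exact min_le_left _ _

/-- The quadratic cost is additive over coordinates, so the inequality tensorizes: the
one-dimensional case, applied to one coordinate with the others frozen, shows that the partial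
integrals satisfy the hypothesis in the remaining coordinates. -/
theorem lintegral_mul_lintegral_pi_gaussianReal_le {v : ℝ≥0} (hv : v ≠ 0) (ι : Type*) [Fintype ι] :
    ∀ {f g : (ι → ℝ) → ℝ≥0∞}, Measurable f → Measurable g →
      (∀ x y, f x * g y ≤ ENNReal.ofReal (Real.exp ((∑ i, (x i - y i) ^ 2) / (4 * v)))) →
      (∫⁻ x, f x ∂(Measure.pi fun _ => gaussianReal 0 v)) *
        ∫⁻ x, g x ∂(Measure.pi fun _ => gaussianReal 0 v) ≤ 1 := by
  refine Fintype.induction_empty_option (P := fun ι _ => ∀ {f g : (ι → ℝ) → ℝ≥0∞},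
    Measurable f → Measurable g →
      (∀ x y, f x * g y ≤ ENNReal.ofReal (Real.exp ((∑ i, (x i - y i) ^ 2) / (4 * v)))) →
      (∫⁻ x, f x ∂(Measure.pi fun _ => gaussianReal 0 v)) *
        ∫⁻ x, g x ∂(Measure.pi fun _ => gaussianReal 0 v) ≤ 1) ?_ ?_ ?_ ι
  · intro α β _ e ih f g hf hg H
    let _ := Fintype.ofEquiv β e.symm
    have hmp := measurePreserving_piCongrLeft (fun _ : β => gaussianReal 0 v) e
    rw [← hmp.lintegral_comp hf, ← hmp.lintegral_comp hg]
    refine ih (hf.comp hmp.measurable) (hg.comp hmp.measurable) fun x y => ?_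
    refine (H _ _).trans (le_of_eq ?_)
    congr 3
    rw [← e.sum_comp]
    simp [MeasurableEquiv.coe_piCongrLeft, Equiv.piCongrLeft_apply_apply]
  · intro f g hf hg H
    have := H default default
    simp only [Measure.pi_of_empty _ (default : PEmpty → ℝ), lintegral_dirac]
    simpa using this
  · intro α _ ih f g hf hg H
    have hmp := Measure.pi_map_piOptionEquivProd (fun _ : Option α => gaussianReal 0 v)
    have hconv : ∀ {f : (Option α → ℝ) → ℝ≥0∞}, Measurable f →
        ∫⁻ x, f x ∂(Measure.pi fun _ => gaussianReal 0 v) =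
        ∫⁻ x, ∫⁻ y, f ((MeasurableEquiv.piOptionEquivProd fun _ => ℝ).symm (x, y))
          ∂(gaussianReal 0 v) ∂(Measure.pi fun _ => gaussianReal 0 v) := by
      intro f hf
      rw [← hmp, lintegral_map hf (MeasurableEquiv.measurable _), lintegral_prod]
      exact (hf.comp (MeasurableEquiv.measurable _)).aemeasurable
    have hcm : ∀ {f : (Option α → ℝ) → ℝ≥0∞}, Measurable f → Measurable fun z : (α → ℝ) × ℝ =>
        f ((MeasurableEquiv.piOptionEquivProd fun _ => ℝ).symm z) :=
      fun hf => hf.comp (MeasurableEquiv.measurable _)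
    rw [hconv hf, hconv hg]
    refine ih (hcm hf).lintegral_prod_right' (hcm hg).lintegral_prod_right' fun x y => ?_
    have key := lintegral_mul_lintegral_gaussianReal_le hv
      (f := fun s => f ((MeasurableEquiv.piOptionEquivProd fun _ => ℝ).symm (x, s)))
      (g := fun s => ENNReal.ofReal (Real.exp (-((∑ i, (x i - y i) ^ 2) / (4 * v)))) *
        g ((MeasurableEquiv.piOptionEquivProd fun _ => ℝ).symm (y, s)))
      ((hcm hf).comp measurable_prodMk_left) (((hcm hg).comp measurable_prodMk_left).const_mul _)
      (fun s t => by
        have := H ((MeasurableEquiv.piOptionEquivProd fun _ => ℝ).symm (x, s))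
          ((MeasurableEquiv.piOptionEquivProd fun _ => ℝ).symm (y, t))
        rw [mul_left_comm]
        refine (mul_le_mul_right this _).trans ?_
        rw [← ENNReal.ofReal_mul (Real.exp_pos _).le, ← Real.exp_add, Fintype.sum_option]
        refine ENNReal.ofReal_le_ofReal (Real.exp_le_exp.2 (le_of_eq ?_))
        have e1 : ∀ (x : α → ℝ) (s : ℝ),
            (MeasurableEquiv.piOptionEquivProd fun _ : Option α => ℝ).symm (x, s) none = s :=
          fun _ _ => rfl
        have e2 : ∀ (x : α → ℝ) (s : ℝ) (i : α),
            (MeasurableEquiv.piOptionEquivProd fun _ : Option α => ℝ).symm (x, s) (some i) = x i :=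
          fun _ _ _ => rfl
        simp only [e1, e2]
        ring)
    rw [lintegral_const_mul' _ _ ENNReal.ofReal_ne_top, mul_left_comm] at key
    set c := (∑ i, (x i - y i) ^ 2) / (4 * (v : ℝ))
    have hc : ENNReal.ofReal (Real.exp c) * ENNReal.ofReal (Real.exp (-c)) = 1 := by
      rw [← ENNReal.ofReal_mul (Real.exp_pos _).le, ← Real.exp_add]
      simp
    have := mul_le_mul_right key (ENNReal.ofReal (Real.exp c))
    rwa [← mul_assoc, hc, one_mul, mul_one] at this

theorem pi_gaussianReal_mul_le {v : ℝ≥0} (hv : v ≠ 0) {ι : Type*} [Fintype ι]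
    {S B : Set (ι → ℝ)} (hS : MeasurableSet S) (hB : MeasurableSet B) {D : ℝ}
    (h : ∀ x ∈ S, ∀ y ∈ B, D ≤ ∑ i, (x i - y i) ^ 2) :
    (Measure.pi fun _ => gaussianReal 0 v) S * (Measure.pi fun _ => gaussianReal 0 v) B ≤
      ENNReal.ofReal (Real.exp (-(D / (4 * v)))) := by
  have hv' : (0 : ℝ) < v := by positivity
  -- The functional inequality is tested on the indicators of the two sets, one of them weighted by
  -- the minimal cost between the sets.
  have := lintegral_mul_lintegral_pi_gaussianReal_le hv ι
    (f := S.indicator fun _ => ENNReal.ofReal (Real.exp (D / (4 * v))))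
    (g := B.indicator fun _ => 1) (measurable_const.indicator hS) (measurable_const.indicator hB)
    (fun x y => by
      by_cases hx : x ∈ S
      · by_cases hy : y ∈ B
        · simp only [hx, hy, Set.indicator_of_mem, mul_one]
          refine ENNReal.ofReal_le_ofReal (Real.exp_le_exp.2 ?_)
          gcongr
          exact h x hx y hy
        · simp [hy]
      · simp [hx])
  rw [lintegral_indicator_const hS, lintegral_indicator_const hB, one_mul] at this
  have hc : ENNReal.ofReal (Real.exp (-(D / (4 * v)))) * ENNReal.ofReal (Real.exp (D / (4 * v)))
      = 1 := by
    rw [← ENNReal.ofReal_mul (Real.exp_pos _).le, ← Real.exp_add]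
    simp
  have := mul_le_mul_right this (ENNReal.ofReal (Real.exp (-(D / (4 * v)))))
  rwa [← mul_assoc, ← mul_assoc, hc, one_mul, mul_one] at this

theorem ofReal_integral_le_lintegral {α : Type*} [MeasurableSpace α] {μ : Measure α} {f : α → ℝ}
    (hf : Integrable f μ) : ENNReal.ofReal (∫ x, f x ∂μ) ≤ ∫⁻ x, ENNReal.ofReal (f x) ∂μ := by
  rw [integral_eq_lintegral_pos_part_sub_lintegral_neg_part hf]
  refine (ENNReal.ofReal_le_ofReal (sub_le_self _ ENNReal.toReal_nonneg)).trans ?_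
  exact ENNReal.ofReal_toReal_le

theorem pi_gaussianReal_lipschitz_le {v : ℝ≥0} (hv : v ≠ 0) {ι : Type*} [Fintype ι]
    {F : (ι → ℝ) → ℝ} (hF : Measurable F)
    (hFi : Integrable F (Measure.pi fun _ => gaussianReal 0 v)) {L : ℝ} (hL : 0 < L)
    (hlip : ∀ x y, F x - F y ≤ L * √(∑ i, (x i - y i) ^ 2)) {t : ℝ} (ht : 0 ≤ t) :
    (Measure.pi fun _ => gaussianReal 0 v)
        {x | (∫ y, F y ∂(Measure.pi fun _ => gaussianReal 0 v)) + t ≤ F x} ≤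
      ENNReal.ofReal (Real.exp (-(t ^ 2 / (4 * v * L ^ 2)))) := by
  have hv' : (0 : ℝ) < v := by positivity
  set γ : Measure (ι → ℝ) := Measure.pi fun _ => gaussianReal 0 v
  set m := ∫ y, F y ∂γ
  -- This choice maximizes `l t - l² L² v`, the exponent left after Markov's inequality.
  set l := t / (2 * L ^ 2 * v) with hl
  have hl0 : 0 ≤ l := by positivity
  set f : (ι → ℝ) → ℝ≥0∞ := fun x => ENNReal.ofReal (Real.exp (l * (F x - m) - l ^ 2 * L ^ 2 * v))
  have hf : Measurable f := by fun_prop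
  have hg : Measurable fun x => ENNReal.ofReal (Real.exp (-(l * (F x - m)))) := by fun_prop
  have key := lintegral_mul_lintegral_pi_gaussianReal_le hv ι hf hg (fun x y => by
    rw [← ENNReal.ofReal_mul (Real.exp_pos _).le, ← Real.exp_add]
    refine ENNReal.ofReal_le_ofReal (Real.exp_le_exp.2 ?_)
    set d := √(∑ i, (x i - y i) ^ 2) with hd
    have hd2 : ∑ i, (x i - y i) ^ 2 = d ^ 2 :=
      (Real.sq_sqrt (Finset.sum_nonneg fun i _ => sq_nonneg _)).symm
    rw [hd2, le_div_iff₀ (by positivity)]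
    have h1 := mul_le_mul_of_nonneg_left (hlip x y) hl0
    have h2 : l * (F x - m) - l ^ 2 * L ^ 2 * v + -(l * (F y - m)) ≤
        l * (L * d) - l ^ 2 * L ^ 2 * v := by linarith
    refine (mul_le_mul_of_nonneg_right h2 (by positivity)).trans ?_
    -- Young's inequality `l L d ≤ d² / (4v) + l² L² v`.
    nlinarith [sq_nonneg (d - 2 * l * L * v)])
  -- Jensen's inequality for the exponential of a centred variable, obtained from `exp x ≥ 1 + x`.
  have hg1 : 1 ≤ ∫⁻ x, ENNReal.ofReal (Real.exp (-(l * (F x - m)))) ∂γ := by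
    have hi : Integrable (fun x => 1 - l * (F x - m)) γ :=
      (integrable_const 1).sub ((hFi.sub (integrable_const m)).const_mul l)
    have h0 : ∫ x, (1 - l * (F x - m)) ∂γ = 1 := by
      have hs : Integrable (fun x => l * (F x - m)) γ := (hFi.sub (integrable_const m)).const_mul l
      rw [integral_sub (integrable_const 1) hs, integral_const_mul, integral_sub hFi (integrable_const m)]
      simp [m]
    calc (1 : ℝ≥0∞) = ENNReal.ofReal (∫ x, (1 - l * (F x - m)) ∂γ) := by rw [h0]; simp
      _ ≤ ∫⁻ x, ENNReal.ofReal (1 - l * (F x - m)) ∂γ := ofReal_integral_le_lintegral hi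
      _ ≤ _ := by
        refine lintegral_mono fun x => ENNReal.ofReal_le_ofReal ?_
        linarith [Real.add_one_le_exp (-(l * (F x - m)))]
  have hf1 : ∫⁻ x, f x ∂γ ≤ 1 := by
    refine le_trans ?_ key
    exact le_mul_of_one_le_right zero_le hg1
  have hset : {x | m + t ≤ F x} ⊆
      {x | ENNReal.ofReal (Real.exp (t ^ 2 / (4 * v * L ^ 2))) ≤ f x} := by
    intro x hx
    refine ENNReal.ofReal_le_ofReal (Real.exp_le_exp.2 ?_)
    have hx' : m + t ≤ F x := hx
    have h1 : l * t ≤ l * (F x - m) := mul_le_mul_of_nonneg_left (by linarith) hl0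
    have h2 : l * t - l ^ 2 * L ^ 2 * v = t ^ 2 / (4 * v * L ^ 2) := by
      rw [hl]; field_simp; ring
    linarith
  refine (measure_mono hset).trans ?_
  refine (meas_ge_le_lintegral_div hf.aemeasurable ?_ ENNReal.ofReal_ne_top).trans ?_
  · simpa using Real.exp_pos _
  · refine (ENNReal.div_le_div_right hf1 _).trans ?_
    rw [Real.exp_neg, ENNReal.ofReal_inv_of_pos (Real.exp_pos _), one_div]

variable {p N : ℕ}

/-! ### The multilinear form of a tensor -/

/-- The normalized Euclidean norm `‖u‖₂ / √N`. -/
noncomputable def rms (u : Fin N → ℝ) : ℝ := norm2 u / √N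

/-- The multilinear form `A(x₁, …, x_p)`. -/
noncomputable def form (A : Tensor p N) (x : Fin p → Fin N → ℝ) : ℝ := ∑ i, A i * ∏ k, x k (i k)

/-- The normalized injective norm of `A` is at most `s`. -/
def InjBound (A : Tensor p N) (s : ℝ) : Prop := ∀ x, |form A x| ≤ s * N * ∏ k, rms (x k)

theorem norm2_eq_norm (u : Fin N → ℝ) : norm2 u = ‖WithLp.toLp 2 u‖ := by
  simp [norm2, EuclideanSpace.norm_eq]

theorem inner_eq_inner (u v : Fin N → ℝ) :
    inner u v = Inner.inner ℝ (WithLp.toLp 2 u) (WithLp.toLp 2 v) := by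
  simp [inner, PiLp.inner_apply, mul_comm]

theorem norm2_nonneg (u : Fin N → ℝ) : 0 ≤ norm2 u := Real.sqrt_nonneg _

theorem norm2_sq (u : Fin N → ℝ) : norm2 u ^ 2 = ∑ i, u i ^ 2 :=
  Real.sq_sqrt (Finset.sum_nonneg fun _ _ => sq_nonneg _)

theorem rms_nonneg (u : Fin N → ℝ) : 0 ≤ rms u := div_nonneg (norm2_nonneg u) (Real.sqrt_nonneg _)

theorem norm2_eq_rms (hN : 0 < N) (u : Fin N → ℝ) : norm2 u = √N * rms u := by
  have : 0 < √(N : ℝ) := Real.sqrt_pos.2 (by exact_mod_cast hN)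
  rw [rms]; field_simp

theorem rms_sq (u : Fin N → ℝ) : rms u ^ 2 = (∑ i, u i ^ 2) / N := by
  rw [rms, div_pow, norm2_sq, Real.sq_sqrt (Nat.cast_nonneg _)]

theorem rms_add_le (u v : Fin N → ℝ) : rms (u + v) ≤ rms u + rms v := by
  rw [rms, rms, rms, ← add_div]
  gcongr
  simp only [norm2_eq_norm, WithLp.toLp_add]
  exact norm_add_le _ _

theorem rms_smul (c : ℝ) (u : Fin N → ℝ) : rms (c • u) = |c| * rms u := by
  simp only [rms, norm2_eq_norm, WithLp.toLp_smul, norm_smul, Real.norm_eq_abs, mul_div_assoc]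

@[simp] theorem rms_zero : rms (0 : Fin N → ℝ) = 0 := by simp [rms, norm2]

theorem rms_le_rms {u v : Fin N → ℝ} (h : ∀ i, |u i| ≤ |v i|) : rms u ≤ rms v := by
  rw [rms, rms, norm2, norm2]
  gcongr √?_ / √N
  exact Finset.sum_le_sum fun i _ => sq_le_sq.2 (h i)

theorem rms_le_of_forall_abs_le {u : Fin N → ℝ} {R : ℝ} (hR : 0 ≤ R) (h : ∀ i, |u i| ≤ R) :
    rms u ≤ R := by
  refine le_of_sq_le_sq ?_ hR
  rw [rms_sq]
  refine div_le_of_le_mul₀ (Nat.cast_nonneg _) (sq_nonneg _) ?_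
  calc ∑ i, u i ^ 2 ≤ ∑ _i : Fin N, R ^ 2 := Finset.sum_le_sum fun i _ => sq_le_sq' 
        (by linarith [neg_abs_le (u i), h i]) ((le_abs_self _).trans (h i))
    _ = R ^ 2 * N := by simp [mul_comm]

theorem rms_le_one_of_mem_hilbertCube {u : Fin N → ℝ} (hu : u ∈ hilbertCube N) : rms u ≤ 1 :=
  rms_le_of_forall_abs_le zero_le_one fun i => abs_le.2 (hu i)

theorem abs_inner_le (hN : 0 < N) (u v : Fin N → ℝ) : |inner u v| ≤ N * (rms u * rms v) := by
  rw [inner_eq_inner]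
  refine (abs_real_inner_le_norm _ _).trans (le_of_eq ?_)
  rw [← norm2_eq_norm, ← norm2_eq_norm, norm2_eq_rms hN, norm2_eq_rms hN]
  calc _ = (√(N : ℝ)) ^ 2 * (rms u * rms v) := by ring
    _ = _ := by rw [Real.sq_sqrt (Nat.cast_nonneg _)]

theorem rms_le_of_forall_inner_le (hN : 0 < N) {d : Fin N → ℝ} {c : ℝ} (hc : 0 ≤ c)
    (h : ∀ y, rms y ≤ 1 → inner y d ≤ c * N) : rms d ≤ c := by
  rcases (rms_nonneg d).eq_or_lt with h0 | h0
  · rwa [← h0]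
  have hN' : (0 : ℝ) < N := by exact_mod_cast hN
  have := h ((rms d)⁻¹ • d) (by rw [rms_smul, abs_of_pos (by positivity), inv_mul_cancel₀ h0.ne'])
  have e : inner ((rms d)⁻¹ • d) d = rms d * N := by
    have h1 : inner ((rms d)⁻¹ • d) d = (rms d)⁻¹ * ∑ i, d i ^ 2 := by
      simp only [inner, Pi.smul_apply, smul_eq_mul, Finset.mul_sum]
      exact Finset.sum_congr rfl fun i _ => by ring
    rw [h1, ← mul_div_cancel_right₀ (∑ i, d i ^ 2) hN'.ne', mul_div_right_comm, ← rms_sq]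
    field_simp
  rw [e] at this
  exact le_of_mul_le_mul_right this hN'

theorem eval_eq_form (A : Tensor p N) (u : Fin N → ℝ) : eval A u = form A fun _ => u := rfl

theorem form_sub (A B : Tensor p N) (x : Fin p → Fin N → ℝ) :
    form (A - B) x = form A x - form B x := by
  simp [form, sub_mul, Finset.sum_sub_distrib]

theorem form_add (A B : Tensor p N) (x : Fin p → Fin N → ℝ) :
    form (A + B) x = form A x + form B x := by
  simp [form, add_mul, Finset.sum_add_distrib]

theorem form_smul (c : ℝ) (A : Tensor p N) (x : Fin p → Fin N → ℝ) :
    form (c • A) x = c * form A x := by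
  simp [form, Finset.mul_sum, mul_assoc]

theorem inner_marginal {q : ℕ} (A : Tensor (q + 1) N) (y w : Fin N → ℝ) :
    inner y (marginal A w) = form A (Fin.cons y fun _ => w) := by
  rw [form, ← (Fin.consEquiv fun _ => Fin N).sum_comp, Fintype.sum_prod_type, inner]
  refine Finset.sum_congr rfl fun j _ => ?_
  rw [marginal, Finset.mul_sum]
  refine Finset.sum_congr rfl fun i _ => ?_
  have : (fun k : Fin (q + 1) => if h : (k : ℕ) = 0 then j else i ⟨(k : ℕ) - 1, by omega⟩) =
      (Fin.cons j i : Fin (q + 1) → Fin N) := by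
    funext k
    refine Fin.cases ?_ (fun k => ?_) k <;> simp
  rw [this, Fin.prod_univ_succ]
  change y j * (A (Fin.cons j i) * ∏ l, w (i l)) = A (Fin.cons j i) * (y j * ∏ l, w (i l))
  ring

theorem InjBound.mono {A : Tensor p N} {s t : ℝ} (h : InjBound A s) (hst : s ≤ t) :
    InjBound A t := fun x => (h x).trans <| by
  have := Finset.prod_nonneg fun k (_ : k ∈ Finset.univ) => rms_nonneg (x k)
  gcongr

theorem InjBound.add {A B : Tensor p N} {s t : ℝ} (hA : InjBound A s) (hB : InjBound B t) :
    InjBound (A + B) (s + t) := fun x => by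
  rw [form_add, add_mul, add_mul]
  exact (abs_add_le _ _).trans (add_le_add (hA x) (hB x))

theorem InjBound.smul {A : Tensor p N} {s : ℝ} (hA : InjBound A s) (c : ℝ) :
    InjBound (c • A) (|c| * s) := fun x => by
  rw [form_smul, abs_mul, mul_assoc, mul_assoc, ← mul_assoc s]
  exact mul_le_mul_of_nonneg_left (hA x) (abs_nonneg c)

theorem form_eq_multilinearMap (A : Tensor p N) :
    ∃ f : MultilinearMap ℝ (fun _ : Fin p => EuclideanSpace ℝ (Fin N)) ℝ,
      ∀ x : Fin p → Fin N → ℝ, form A x = f fun k => WithLp.toLp 2 (x k) := by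
  refine ⟨∑ i : Fin p → Fin N, A i • (MultilinearMap.mkPiAlgebra ℝ (Fin p) ℝ).compLinearMap
    fun k => EuclideanSpace.projₗ (i k), fun x => ?_⟩
  simp [form]

theorem form_sub_form_le (hN : 0 < N) {A : Tensor p N} {s : ℝ} (hs : 0 ≤ s) (hA : InjBound A s)
    {x y : Fin p → Fin N → ℝ} {R D : ℝ} (hR : 0 ≤ R) (hD : 0 ≤ D) (hx : ∀ k, rms (x k) ≤ R)
    (hy : ∀ k, rms (y k) ≤ R) (hxy : ∀ k, rms (x k - y k) ≤ D) :
    |form A x - form A y| ≤ s * p * R ^ (p - 1) * D * N := by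
  rcases Nat.eq_zero_or_pos p with rfl | hp
  · have : x = y := Subsingleton.elim _ _
    simp [this]
  obtain ⟨f, hf⟩ := form_eq_multilinearMap A
  have hN' : 0 < √(N : ℝ) := Real.sqrt_pos.2 (by exact_mod_cast hN)
  -- Passing from `rms` to the Euclidean norm costs a factor `√N` in each of the `p` slots.
  have hb : ∀ m, ‖f m‖ ≤ s * N / √N ^ p * ∏ k, ‖m k‖ := by
    intro m
    have := hA fun k => WithLp.ofLp (m k)
    rw [hf] at this
    simp only [WithLp.toLp_ofLp, rms, norm2_eq_norm, Finset.prod_div_distrib, Finset.prod_const,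
      Finset.card_univ, Fintype.card_fin] at this
    rw [Real.norm_eq_abs]
    refine this.trans (le_of_eq ?_)
    field_simp
  have key := f.norm_image_sub_le_of_bound (by positivity) hb (fun k => WithLp.toLp 2 (x k))
    (fun k => WithLp.toLp 2 (y k))
  rw [← hf, ← hf, Real.norm_eq_abs, Fintype.card_fin] at key
  have hn : ∀ {z : Fin p → Fin N → ℝ} {c : ℝ}, 0 ≤ c → (∀ k, rms (z k) ≤ c) →
      ‖fun k => WithLp.toLp 2 (z k)‖ ≤ √N * c := by
    intro z c hc hz
    refine (pi_norm_le_iff_of_nonneg (by positivity)).2 fun k => ?_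
    rw [← norm2_eq_norm, norm2_eq_rms hN]
    gcongr
    exact hz k
  refine key.trans ?_
  have h1 : max ‖fun k => WithLp.toLp 2 (x k)‖ ‖fun k => WithLp.toLp 2 (y k)‖ ≤ √N * R :=
    max_le (hn hR hx) (hn hR hy)
  have h2 : ‖(fun k => WithLp.toLp 2 (x k)) - fun k => WithLp.toLp 2 (y k)‖ ≤ √N * D :=
    hn hD hxy
  calc _ ≤ s * N / √N ^ p * p * (√N * R) ^ (p - 1) * (√N * D) := by gcongr
    _ = s * p * R ^ (p - 1) * D * N * (√N ^ (p - 1) * √N) / √N ^ p := by rw [mul_pow]; ring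
    _ = _ := by
      rw [← pow_succ, Nat.sub_add_cancel hp]
      field_simp

theorem InjBound.form_le {A : Tensor p N} {s : ℝ} (hs : 0 ≤ s) (hA : InjBound A s)
    {x : Fin p → Fin N → ℝ} {R : ℝ} (hx : ∀ k, rms (x k) ≤ R) :
    |form A x| ≤ s * R ^ p * N := by
  refine (hA x).trans ?_
  have : ∏ k, rms (x k) ≤ R ^ p := by
    calc ∏ k, rms (x k) ≤ ∏ _k : Fin p, R :=
          Finset.prod_le_prod (fun k _ => rms_nonneg _) fun k _ => hx k
      _ = R ^ p := by simp
  calc s * N * ∏ k, rms (x k) ≤ s * N * R ^ p := by gcongr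
    _ = _ := by ring

theorem form_sub_form_le_of_injBound (hN : 0 < N) {A B : Tensor p N} {s δ : ℝ} (hs : 0 ≤ s)
    (hδ : 0 ≤ δ) (hB : InjBound B s) (hAB : InjBound (A - B) δ)
    {x y : Fin p → Fin N → ℝ} {R D : ℝ} (hR : 0 ≤ R) (hD : 0 ≤ D) (hx : ∀ k, rms (x k) ≤ R)
    (hy : ∀ k, rms (y k) ≤ R) (hxy : ∀ k, rms (x k - y k) ≤ D) :
    |form A x - form B y| ≤ (δ * R ^ p + s * p * R ^ (p - 1) * D) * N := by
  have h1 := hAB.form_le hδ hx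
  have h2 := form_sub_form_le hN hs hB hR hD hx hy hxy
  rw [form_sub] at h1
  have e : form A x - form B y = (form A x - form B x) + (form B x - form B y) := by ring
  rw [e, add_mul]
  exact (abs_add_le _ _).trans (add_le_add h1 h2)

/-- By duality it suffices to test against `y` with `rms y ≤ 1`, which turns both marginals into
forms with `y` in the first slot. That slot contributes no difference, and `1 ≤ R` lets `y` obey the
common bound. -/
theorem rms_marginal_sub_le (hN : 0 < N) (hp : 0 < p) {A B : Tensor p N} {s δ : ℝ} (hs : 0 ≤ s)
    (hδ : 0 ≤ δ) (hB : InjBound B s) (hAB : InjBound (A - B) δ) {u w : Fin N → ℝ} {R D : ℝ}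
    (hR : 1 ≤ R) (hD : 0 ≤ D) (hu : rms u ≤ R) (hw : rms w ≤ R) (huw : rms (u - w) ≤ D) :
    rms (marginal A u - marginal B w) ≤ δ * R ^ p + s * p * R ^ (p - 1) * D := by
  have hR0 : 0 ≤ R := zero_le_one.trans hR
  obtain ⟨q, rfl⟩ : ∃ q, p = q + 1 := ⟨p - 1, by omega⟩
  refine rms_le_of_forall_inner_le hN (by positivity) fun y hy => ?_
  have e : inner y (marginal A u - marginal B w) =
      inner y (marginal A u) - inner y (marginal B w) := by
    simp [inner, mul_sub, Finset.sum_sub_distrib]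
  rw [e, inner_marginal, inner_marginal]
  refine (le_abs_self _).trans
    (form_sub_form_le_of_injBound hN hs hδ hB hAB hR0 hD ?_ ?_ ?_)
  · refine Fin.cases ?_ (fun k => ?_)
    · simpa using hy.trans hR
    · simpa using hu
  · refine Fin.cases ?_ (fun k => ?_)
    · simpa using hy.trans hR
    · simpa using hw
  · refine Fin.cases ?_ (fun k => ?_)
    · simpa using hD
    · simpa using huw

/-- Cauchy–Schwarz, because the sum of squares of the rank-one tensor factorizes. This converts the
Euclidean distance of Gaussian concentration into the injective norm of the stability estimates. -/
theorem injBound_of_sum_sq_le (hN : 0 < N) {A : Tensor p N} {r : ℝ} (hr : 0 ≤ r)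
    (h : ∑ i, A i ^ 2 ≤ r ^ 2 * N ^ 2 / N ^ p) : InjBound A r := by
  intro x
  have hN' : (0 : ℝ) < N := by exact_mod_cast hN
  have hP : 0 ≤ ∏ k, rms (x k) := Finset.prod_nonneg fun k _ => rms_nonneg (x k)
  refine abs_le_of_sq_le_sq ?_ (by positivity)
  have cs := Finset.sum_mul_sq_le_sq_mul_sq Finset.univ A fun i => ∏ k, x k (i k)
  refine cs.trans ?_
  have e : ∑ i : Fin p → Fin N, (∏ k, x k (i k)) ^ 2 = N ^ p * (∏ k, rms (x k)) ^ 2 := by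
    simp_rw [← Finset.prod_pow, rms_sq]
    rw [Finset.prod_div_distrib, Finset.prod_univ_sum, Fintype.piFinset_univ]
    simp only [Finset.prod_const, Finset.card_univ, Fintype.card_fin]
    field_simp
  rw [e]
  calc _ ≤ r ^ 2 * N ^ 2 / N ^ p * (N ^ p * (∏ k, rms (x k)) ^ 2) := by gcongr
    _ = _ := by field_simp

/-! ### Infima over cubes -/

theorem abs_eval_le_sum {A : Tensor p N} {u : Fin N → ℝ} (hu : u ∈ hilbertCube N) :
    |eval A u| ≤ ∑ i, |A i| := by
  refine (Finset.abs_sum_le_sum_abs _ _).trans (Finset.sum_le_sum fun i _ => ?_)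
  rw [abs_mul, Finset.abs_prod]
  exact mul_le_of_le_one_right (abs_nonneg _)
    (Finset.prod_le_one (fun _ _ => abs_nonneg _) fun k _ => abs_le.2 (hu _))

theorem bddBelow_eval_image (A : Tensor p N) {S : Set (Fin N → ℝ)} (hS : S ⊆ hilbertCube N) :
    BddBelow (eval A '' S) := by
  refine ⟨-∑ i, |A i|, ?_⟩
  rintro _ ⟨u, hu, rfl⟩
  exact neg_le_of_abs_le (abs_eval_le_sum (hS hu))

theorem infOn_le (A : Tensor p N) {S : Set (Fin N → ℝ)} (hS : S ⊆ hilbertCube N) {u : Fin N → ℝ}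
    (hu : u ∈ S) : infOn A S ≤ eval A u :=
  csInf_le (bddBelow_eval_image A hS) ⟨u, hu, rfl⟩

theorem le_infOn {A : Tensor p N} {S : Set (Fin N → ℝ)} (hS : S.Nonempty) {c : ℝ}
    (h : ∀ u ∈ S, c ≤ eval A u) : c ≤ infOn A S := by
  refine le_csInf (hS.image _) ?_
  rintro _ ⟨u, hu, rfl⟩
  exact h u hu

theorem infOn_le_add {A B : Tensor p N} {S : Set (Fin N → ℝ)} (hS : S ⊆ hilbertCube N)
    (hS0 : S.Nonempty) {δ : ℝ} (hδ : 0 ≤ δ) (h : InjBound (A - B) δ) :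
    infOn A S ≤ infOn B S + δ * N := by
  rw [← sub_le_iff_le_add]
  refine le_infOn hS0 fun u hu => ?_
  have h1 := h.form_le hδ (x := fun _ => u) fun _ => rms_le_one_of_mem_hilbertCube (hS hu)
  rw [form_sub, ← eval_eq_form, ← eval_eq_form, one_pow, mul_one] at h1
  have h2 := infOn_le A hS hu
  linarith [le_abs_self (eval A u - eval B u)]

theorem binaryCube_subset_hilbertCube : binaryCube N ⊆ hilbertCube N := fun σ hσ i => by
  rcases hσ i with h | h <;> simp [h]

theorem binaryCube_nonempty : (binaryCube N).Nonempty := ⟨fun _ => 1, fun _ => Or.inr rfl⟩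

theorem hilbertCube_nonempty : (hilbertCube N).Nonempty :=
  binaryCube_nonempty.mono binaryCube_subset_hilbertCube

theorem groundState_sub_le (hN : 0 < N) (A B : Tensor p N) :
    groundState A - groundState B ≤ √(N ^ p) / N * √(∑ i, (A i - B i) ^ 2) := by
  have hN' : (0 : ℝ) < N := by exact_mod_cast hN
  have hb : InjBound (A - B) (√(N ^ p) / N * √(∑ i, (A i - B i) ^ 2)) := by
    refine injBound_of_sum_sq_le hN (by positivity) (le_of_eq ?_)
    rw [mul_pow, div_pow, Real.sq_sqrt (by positivity),
      Real.sq_sqrt (Finset.sum_nonneg fun _ _ => sq_nonneg _)]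
    simp only [Pi.sub_apply]
    field_simp
  have := infOn_le_add binaryCube_subset_hilbertCube binaryCube_nonempty (by positivity) hb
  rw [groundState, groundState, ← sub_div, div_le_iff₀ hN']
  linarith

/-! ### Linear functionals of the couplings -/

instance : IsProbabilityMeasure (couplingLaw p N) := by
  unfold couplingLaw; infer_instance

theorem couplingVariance_ne_zero (hN : 0 < N) : (1 / (N : ℝ≥0) ^ (p - 1)) ≠ 0 := by
  have : (N : ℝ≥0) ≠ 0 := by exact_mod_cast hN.ne'
  positivity

theorem integrable_coupling (i : Fin p → Fin N) :
    Integrable (fun A : Tensor p N => A i) (couplingLaw p N) := by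
  have h : Integrable id (gaussianReal 0 (1 / (N : ℝ≥0) ^ (p - 1))) :=
    (memLp_id_gaussianReal' 1 (by simp)).integrable le_rfl
  exact (measurePreserving_eval (fun _ : Fin p → Fin N =>
    gaussianReal 0 (1 / (N : ℝ≥0) ^ (p - 1))) i).integrable_comp_of_integrable h

theorem integral_coupling (i : Fin p → Fin N) : ∫ A : Tensor p N, A i ∂(couplingLaw p N) = 0 := by
  have h := (measurePreserving_eval (fun _ : Fin p → Fin N =>
    gaussianReal 0 (1 / (N : ℝ≥0) ^ (p - 1))) i)
  have := integral_map (μ := couplingLaw p N) h.measurable.aemeasurable (f := id)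
    measurable_id.aestronglyMeasurable
  simp only [id] at this
  rw [couplingLaw] at *
  rw [h.map_eq, integral_id_gaussianReal] at this
  exact this.symm

theorem couplingLaw_linear_le (hN : 0 < N) (c : (Fin p → Fin N) → ℝ) {V : ℝ} (hV : 0 < V)
    (hc : ∑ i, c i ^ 2 ≤ V) {t : ℝ} (ht : 0 ≤ t) :
    couplingLaw p N {A | t ≤ ∑ i, A i * c i} ≤
      ENNReal.ofReal (Real.exp (-(t ^ 2 * N ^ (p - 1) / (4 * V)))) := by
  have hi : Integrable (fun A : Tensor p N => ∑ i, A i * c i) (couplingLaw p N) :=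
    integrable_finsetSum _ fun i _ => (integrable_coupling i).mul_const _
  have hm : ∫ A : Tensor p N, ∑ i, A i * c i ∂(couplingLaw p N) = 0 := by
    rw [integral_finsetSum _ fun i _ => (integrable_coupling i).mul_const _]
    simp [integral_mul_const, integral_coupling]
  have := pi_gaussianReal_lipschitz_le (couplingVariance_ne_zero (p := p) hN)
    (F := fun A : Tensor p N => ∑ i, A i * c i) (by fun_prop) hi (Real.sqrt_pos.2 hV)
    (fun x y => by
      rw [← Finset.sum_sub_distrib, ← Real.sqrt_mul hV.le]
      refine Real.le_sqrt_of_sq_le ?_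
      simp_rw [← sub_mul]
      refine (Finset.sum_mul_sq_le_sq_mul_sq _ _ _).trans ?_
      rw [mul_comm]
      have := Finset.sum_nonneg fun i (_ : i ∈ Finset.univ) => sq_nonneg (x i - y i)
      gcongr) ht
  rw [← couplingLaw, hm, zero_add, Real.sq_sqrt hV.le] at this
  refine this.trans (le_of_eq ?_)
  congr 3
  push_cast
  have : (N : ℝ) ≠ 0 := by exact_mod_cast hN.ne'
  field_simp

/-! ### Rounding to lattice points -/

theorem form_eq_multilinearMap_pi (A : Tensor p N) :
    ∃ f : MultilinearMap ℝ (fun _ : Fin p => Fin N → ℝ) ℝ,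
      ∀ x : Fin p → Fin N → ℝ, form A x = f x := by
  refine ⟨∑ i : Fin p → Fin N, A i • (MultilinearMap.mkPiAlgebra ℝ (Fin p) ℝ).compLinearMap
    fun k => LinearMap.proj (i k), fun x => ?_⟩
  simp [form]

/-- Each coordinate is rounded up or down according to the sign of `c j`, so the linear functional
cannot decrease, while `|z j| ≤ |x j| + 1`. -/
theorem exists_int_rounding (c x : Fin N → ℝ) :
    ∃ z : Fin N → ℤ, ∑ j, x j * c j ≤ ∑ j, (z j : ℝ) * c j ∧
      ∑ j, (z j : ℝ) ^ 2 ≤ 2 * ∑ j, x j ^ 2 + 2 * N := by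
  refine ⟨fun j => if 0 ≤ c j then ⌈x j⌉ else ⌊x j⌋, Finset.sum_le_sum fun j _ => ?_, ?_⟩
  · beta_reduce
    split_ifs with h
    · exact mul_le_mul_of_nonneg_right (Int.le_ceil _) h
    · exact mul_le_mul_of_nonpos_right (Int.floor_le _) (not_le.1 h).le
  · have e : 2 * ∑ j, x j ^ 2 + 2 * (N : ℝ) = ∑ j, (2 * x j ^ 2 + 2) := by
      simp [Finset.sum_add_distrib, Finset.mul_sum, mul_comm]
    rw [e]
    refine Finset.sum_le_sum fun j _ => ?_
    beta_reduce
    split_ifs with h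
    · nlinarith [Int.le_ceil (x j), Int.ceil_lt_add_one (x j), sq_nonneg (2 * x j - ⌈x j⌉)]
    · nlinarith [Int.floor_le (x j), Int.lt_floor_add_one (x j), sq_nonneg (2 * x j - ⌊x j⌋)]

theorem exists_int_form_ge (hN : 0 < N) (A : Tensor p N) {x : Fin p → Fin N → ℝ}
    (hx : ∀ k, rms (x k) ≤ 1) :
    ∃ z : Fin p → Fin N → ℤ, (∀ k, ∑ j, (z k j : ℝ) ^ 2 ≤ 4 * N) ∧
      form A x ≤ form A fun k j => z k j := by
  have hN' : (0 : ℝ) < N := by exact_mod_cast hN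
  obtain ⟨f, hf⟩ := form_eq_multilinearMap_pi A
  -- The slots are rounded one at a time: with the others frozen the form is linear in the slot `a`,
  -- so rounding it does not lower the value.
  have main : ∀ S : Finset (Fin p), ∃ z : Fin p → Fin N → ℤ,
      (∀ k, ∑ j, (z k j : ℝ) ^ 2 ≤ 4 * N) ∧
        form A x ≤ form A fun k => if k ∈ S then fun j => (z k j : ℝ) else x k := by
    intro S
    induction S using Finset.induction_on with
    | empty => exact ⟨0, by simp, by simp⟩
    | insert a S ha ih =>
      obtain ⟨z, hz, hle⟩ := ih
      set y : Fin p → Fin N → ℝ := fun k => if k ∈ S then fun j => (z k j : ℝ) else x k with hy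
      set l := f.toLinearMap y a with hl
      obtain ⟨w, hw1, hw2⟩ := exists_int_rounding (fun j => l fun i => if j = i then 1 else 0) (x a)
      refine ⟨Function.update z a w, fun k => ?_, hle.trans ?_⟩
      · by_cases hk : k = a
        · subst hk
          have h1 := hx k
          have h2 : ∑ j, x k j ^ 2 ≤ N := by
            have h3 : rms (x k) ^ 2 ≤ 1 := pow_le_one₀ (rms_nonneg _) h1
            rw [rms_sq, div_le_one hN'] at h3
            exact h3
          simp only [Function.update_self]
          linarith
        · simpa [hk] using hz k
      · have e1 : form A y = l (x a) := by
          rw [hf, hl, MultilinearMap.toLinearMap_apply]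
          congr 1
          rw [eq_comm, Function.update_eq_self_iff]
          simp [hy, ha]
        have e2 : (form A fun k => if k ∈ insert a S then
            fun j => ((Function.update z a w k j : ℤ) : ℝ) else x k) = l fun j => (w j : ℝ) := by
          rw [hf, hl, MultilinearMap.toLinearMap_apply]
          congr 1
          funext k
          by_cases hk : k = a
          · subst hk; simp
          · simp [hk, hy]
        rw [e1, e2, LinearMap.pi_apply_eq_sum_univ l, LinearMap.pi_apply_eq_sum_univ l fun j => _]
        simpa using hw1
  obtain ⟨z, hz, h⟩ := main Finset.univ
  exact ⟨z, hz, by simpa using h⟩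

/-- The lattice points of norm at most `2√N`. -/
noncomputable def latticeBall (N : ℕ) : Finset (Fin N → ℤ) :=
  (Fintype.piFinset fun _ => Finset.Icc (-(4 * N : ℤ)) (4 * N)).filter
    fun z => ∑ j, (z j : ℝ) ^ 2 ≤ 4 * N

theorem mem_latticeBall {z : Fin N → ℤ} : z ∈ latticeBall N ↔ ∑ j, (z j : ℝ) ^ 2 ≤ 4 * N := by
  rw [latticeBall, Finset.mem_filter, and_iff_right_iff_imp]
  intro h
  rw [Fintype.mem_piFinset]
  intro j
  have h1 : (z j : ℝ) ^ 2 ≤ 4 * N :=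
    (Finset.single_le_sum (f := fun j => (z j : ℝ) ^ 2) (fun _ _ => sq_nonneg _)
      (Finset.mem_univ j)).trans h
  have h2 : z j ^ 2 ≤ 4 * N := by exact_mod_cast h1
  rw [Finset.mem_Icc]
  constructor <;> nlinarith [Int.le_self_sq (z j), Int.le_self_sq (-z j)]

/-- On the ball `∏ (1 + z_j²) ≤ exp (∑ z_j²) ≤ e^{4N}`, so the count is at most `e^{4N}` times the
sum of `∏ (1 + z_j²)⁻¹`, which factorizes into `N` copies of a convergent series. -/
theorem card_latticeBall_le : ∃ C : ℝ, 1 ≤ C ∧ ∀ N : ℕ, ((latticeBall N).card : ℝ) ≤ C ^ N := by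
  have hs : Summable fun k : ℤ => (1 + (k : ℝ) ^ 2)⁻¹ := by
    have h1 : Summable fun k : ℕ => (1 + (k : ℝ) ^ 2)⁻¹ := by
      refine Summable.of_nonneg_of_le (fun k => by positivity) (fun k => ?_)
        (((Real.summable_nat_pow_inv (p := 2)).2 (by norm_num)).add
          (hasSum_ite_eq (0 : ℕ) (1 : ℝ)).summable)
      rcases Nat.eq_zero_or_pos k with rfl | hk
      · simp
      · have : (0 : ℝ) < k := by exact_mod_cast hk
        simp only [hk.ne', if_false, add_zero]
        gcongr
        linarith
    exact Summable.of_nat_of_neg (by simpa using h1) (by simpa using h1)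
  set c := ∑' k : ℤ, (1 + (k : ℝ) ^ 2)⁻¹ with hc
  have hc0 : 1 ≤ c := by
    have := hs.sum_le_tsum {0} fun i _ => by positivity
    simpa using this
  refine ⟨Real.exp 4 * c, one_le_mul_of_one_le_of_one_le (Real.one_le_exp (by norm_num)) hc0,
    fun N => ?_⟩
  have h1 : ∀ z ∈ latticeBall N, (1 : ℝ) ≤ Real.exp 4 ^ N * ∏ j, (1 + (z j : ℝ) ^ 2)⁻¹ := by
    intro z hz
    rw [mem_latticeBall] at hz
    rw [Finset.prod_inv_distrib, ← div_eq_mul_inv,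
      one_le_div (Finset.prod_pos fun j _ => by positivity), ← Real.exp_nat_mul]
    calc ∏ j, (1 + (z j : ℝ) ^ 2) ≤ ∏ j, Real.exp ((z j : ℝ) ^ 2) :=
          Finset.prod_le_prod (fun j _ => by positivity) fun j _ => by
            linarith [Real.add_one_le_exp ((z j : ℝ) ^ 2)]
      _ = Real.exp (∑ j, (z j : ℝ) ^ 2) := (Real.exp_sum _ _).symm
      _ ≤ _ := Real.exp_le_exp.2 (by linarith)
  calc ((latticeBall N).card : ℝ) = ∑ z ∈ latticeBall N, (1 : ℝ) := by simp
    _ ≤ ∑ z ∈ latticeBall N, Real.exp 4 ^ N * ∏ j, (1 + (z j : ℝ) ^ 2)⁻¹ := Finset.sum_le_sum h1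
    _ ≤ ∑ z ∈ Fintype.piFinset fun _ : Fin N => Finset.Icc (-(4 * N : ℤ)) (4 * N),
        Real.exp 4 ^ N * ∏ j, (1 + (z j : ℝ) ^ 2)⁻¹ :=
      Finset.sum_le_sum_of_subset_of_nonneg (Finset.filter_subset _ _)
        fun z _ _ => mul_nonneg (by positivity) (Finset.prod_nonneg fun j _ => by positivity)
    _ = Real.exp 4 ^ N * ∏ _j : Fin N, ∑ k ∈ Finset.Icc (-(4 * N : ℤ)) (4 * N),
        (1 + (k : ℝ) ^ 2)⁻¹ := by
      rw [← Finset.mul_sum, Finset.prod_univ_sum]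
    _ ≤ Real.exp 4 ^ N * ∏ _j : Fin N, c := by
      gcongr with j
      exact hs.sum_le_tsum _ fun i _ => by positivity
    _ = _ := by simp [mul_pow]

/-! ### The injective norm of a Gaussian tensor -/

theorem injBound_of_lattice (hN : 0 < N) (hp : 0 < p) {A : Tensor p N} {s : ℝ}
    (h : ∀ z ∈ Fintype.piFinset fun _ : Fin p => latticeBall N,
      (form A fun k j => (z k j : ℝ)) ≤ s * N) : InjBound A s := by
  obtain ⟨f, hf⟩ := form_eq_multilinearMap_pi A
  have h1 : ∀ x : Fin p → Fin N → ℝ, (∀ k, rms (x k) ≤ 1) → form A x ≤ s * N := by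
    intro x hx
    obtain ⟨z, hz, hle⟩ := exists_int_form_ge hN A hx
    exact hle.trans (h z (Fintype.mem_piFinset.2 fun k => mem_latticeBall.2 (hz k)))
  have h2 : ∀ x : Fin p → Fin N → ℝ, (∀ k, rms (x k) ≤ 1) → |form A x| ≤ s * N := by
    intro x hx
    refine abs_le'.2 ⟨h1 x hx, ?_⟩
    -- Reversing the sign of one slot turns the upper bound into a bound on the absolute value.
    have := h1 (Function.update x ⟨0, hp⟩ (-x ⟨0, hp⟩)) (fun k => by
      by_cases hk : k = ⟨0, hp⟩
      · subst hk
        rw [Function.update_self, ← neg_one_smul ℝ, rms_smul]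
        simpa using hx _
      · rw [Function.update_of_ne hk]
        exact hx k)
    rw [hf, f.map_update_neg, Function.update_eq_self, ← hf] at this
    exact this
  intro x
  have e : x = fun k => rms (x k) • ((rms (x k))⁻¹ • x k) := by
    funext k
    rcases (rms_nonneg (x k)).eq_or_lt with h0 | h0
    · have hx0 : x k = 0 := by
        have h3 := norm2_eq_rms hN (x k)
        rw [← h0, mul_zero, norm2_eq_norm, norm_eq_zero] at h3
        simpa using h3
      simp [hx0]
    · rw [smul_smul, mul_inv_cancel₀ h0.ne', one_smul]
  have e2 : form A x = (∏ k, rms (x k)) * form A fun k => (rms (x k))⁻¹ • x k := by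
    rw [hf, hf]
    conv_lhs => rw [e]
    rw [f.map_smul_univ, smul_eq_mul]
  have hP : 0 ≤ ∏ k, rms (x k) := Finset.prod_nonneg fun k _ => rms_nonneg (x k)
  rw [e2, abs_mul, abs_of_nonneg hP, mul_comm]
  refine mul_le_mul_of_nonneg_right (h2 _ fun k => ?_) hP
  rw [rms_smul, abs_of_nonneg (inv_nonneg.2 (rms_nonneg _))]
  exact inv_mul_le_one

/-- A union bound over the `p`-tuples of lattice points, at most `C ^ (pN)` in number, at each of
which the form is a Gaussian linear functional. -/
theorem exists_couplingLaw_not_injBound_le (hp : 0 < p) :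
    ∃ s : ℝ, 1 ≤ s ∧ ∀ N : ℕ, 0 < N →
      couplingLaw p N {A | ¬ InjBound A s} ≤ ENNReal.ofReal (Real.exp (-N)) := by
  obtain ⟨C, hC, hcard⟩ := card_latticeBall_le
  have hlog : 0 ≤ Real.log C := Real.log_nonneg hC
  -- Chosen so that each tail is exactly `exp (-(p log C + 1) N)`, which leaves `e^{-N}` after the
  -- union bound.
  set s := √(4 * 4 ^ p * (p * Real.log C + 1)) with hs
  have hs2 : s ^ 2 = 4 * 4 ^ p * (p * Real.log C + 1) := Real.sq_sqrt (by positivity)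
  have hs1 : 1 ≤ s := by
    rw [hs, Real.one_le_sqrt]
    have : (1 : ℝ) ≤ 4 ^ p := one_le_pow₀ (by norm_num)
    have : (0 : ℝ) ≤ p * Real.log C := by positivity
    nlinarith
  refine ⟨s, hs1, fun N hN => ?_⟩
  have hN' : (0 : ℝ) < N := by exact_mod_cast hN
  have hsub : {A : Tensor p N | ¬ InjBound A s} ⊆
      ⋃ z ∈ Fintype.piFinset fun _ : Fin p => latticeBall N,
        {A : Tensor p N | s * N ≤ ∑ i, A i * ∏ k, (z k (i k) : ℝ)} := by
    intro A hA
    by_contra hcon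
    refine hA (injBound_of_lattice hN hp fun z hz => ?_)
    by_contra hlt
    exact hcon (Set.mem_biUnion hz (not_le.1 hlt).le)
  refine (measure_mono hsub).trans ((measure_biUnion_finset_le _ _).trans ?_)
  have hterm : ∀ z ∈ Fintype.piFinset fun _ : Fin p => latticeBall N,
      couplingLaw p N {A : Tensor p N | s * N ≤ ∑ i, A i * ∏ k, (z k (i k) : ℝ)} ≤
        ENNReal.ofReal (Real.exp (-((p * Real.log C + 1) * N))) := by
    intro z hz
    have hc : ∑ i : Fin p → Fin N, (∏ k, (z k (i k) : ℝ)) ^ 2 ≤ (4 * N) ^ p := by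
      simp_rw [← Finset.prod_pow]
      have h0 := Finset.prod_univ_sum (fun _ : Fin p => (Finset.univ : Finset (Fin N)))
        fun k j => (z k j : ℝ) ^ 2
      rw [Fintype.piFinset_univ] at h0
      rw [← h0]
      calc ∏ k, ∑ j, (z k j : ℝ) ^ 2 ≤ ∏ _k : Fin p, (4 * N : ℝ) :=
            Finset.prod_le_prod (fun k _ => Finset.sum_nonneg fun _ _ => sq_nonneg _)
              fun k _ => mem_latticeBall.1 (Fintype.mem_piFinset.1 hz k)
        _ = _ := by simp
    refine (couplingLaw_linear_le hN _ (by positivity) hc (by positivity)).trans ?_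
    refine ENNReal.ofReal_le_ofReal (Real.exp_le_exp.2 (le_of_eq ?_))
    rw [mul_pow, hs2, mul_pow]
    obtain ⟨q, rfl⟩ : ∃ q, p = q + 1 := ⟨p - 1, by omega⟩
    simp only [Nat.add_one_sub_one]
    field_simp
    ring
  refine (Finset.sum_le_sum hterm).trans ?_
  rw [Finset.sum_const, Fintype.card_piFinset, nsmul_eq_mul]
  simp only [Finset.prod_const, Finset.card_univ, Fintype.card_fin]
  rw [← ENNReal.ofReal_natCast, ← ENNReal.ofReal_mul (Nat.cast_nonneg _)]
  refine ENNReal.ofReal_le_ofReal ?_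
  have hle : (((latticeBall N).card ^ p : ℕ) : ℝ) ≤ Real.exp (p * Real.log C * N) := by
    push_cast
    calc ((latticeBall N).card : ℝ) ^ p ≤ (C ^ N) ^ p := by gcongr; exact hcard N
      _ = Real.exp (Real.log C) ^ (N * p) := by rw [Real.exp_log (by linarith), pow_mul]
      _ = _ := by
        rw [← Real.exp_nat_mul]
        congr 1
        push_cast
        ring
  calc _ ≤ Real.exp (p * Real.log C * N) * Real.exp (-((p * Real.log C + 1) * N)) := by gcongr
    _ = _ := by
      rw [← Real.exp_add]
      congr 1
      ring

/-! ### Stability of approximate message passing -/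

theorem abs_trunc_sub_le (M x y : ℝ) : |trunc M x - trunc M y| ≤ |x - y| := by
  rw [trunc, trunc]
  refine (abs_max_sub_max_le_max _ _ _ _).trans ?_
  rw [sub_self, abs_zero, max_eq_right (abs_nonneg _)]
  refine (abs_min_sub_min_le_max _ _ _ _).trans ?_
  rw [sub_self, abs_zero, max_eq_left (abs_nonneg _)]

theorem trunc_mem_Icc {M : ℝ} (hM : 0 ≤ M) (x : ℝ) : trunc M x ∈ Set.Icc (-M) M :=
  ⟨le_max_left _ _, max_le (by linarith) (min_le_right _ _)⟩

section AMP

variable {M ζ : ℝ} {T : ℕ} {f : (t : ℕ) → (Fin t → ℝ) → ℝ} {F : (t : ℕ) → ℝ → (Fin t → ℝ) → ℝ}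

theorem ampIterate_mem_box (hM : 0 ≤ M) (A : Tensor p N) {U0 : Fin N → ℝ} (hU0 : U0 ∈ box M N)
    (t : ℕ) : ampIterate M f F A U0 t ∈ box M N := by
  cases t with
  | zero => rw [ampIterate]; exact hU0
  | succ t => rw [ampIterate]; exact fun j => trunc_mem_Icc hM _

theorem ampOutput_mem_hilbertCube (A : Tensor p N) (U0 : Fin N → ℝ) :
    ampOutput M f F T A U0 ∈ hilbertCube N := fun j =>
  trunc_mem_Icc zero_le_one (ampIterate M f F A U0 T j)

theorem rms_le_of_forall_sq_le {ι : Type*} [Fintype ι] {u : Fin N → ℝ} {w : ι → Fin N → ℝ}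
    {ζ c : ℝ} (hζ : 0 ≤ ζ) (hc : 0 ≤ c) (hw : ∑ s, rms (w s) ^ 2 ≤ c ^ 2)
    (h : ∀ i, |u i| ≤ ζ * √(∑ s, w s i ^ 2)) : rms u ≤ ζ * c := by
  refine le_of_sq_le_sq ?_ (by positivity)
  have h2 : ∀ i, u i ^ 2 ≤ ζ ^ 2 * ∑ s, w s i ^ 2 := fun i => by
    rw [← sq_abs]
    refine (pow_le_pow_left₀ (abs_nonneg _) (h i) 2).trans (le_of_eq ?_)
    rw [mul_pow, Real.sq_sqrt (Finset.sum_nonneg fun _ _ => sq_nonneg _)]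
  calc rms u ^ 2 = (∑ i, u i ^ 2) / N := rms_sq u
    _ ≤ (∑ i, ζ ^ 2 * ∑ s, w s i ^ 2) / N := by gcongr with i; exact h2 i
    _ = ζ ^ 2 * ∑ s, rms (w s) ^ 2 := by
      simp_rw [rms_sq]
      rw [← Finset.mul_sum, Finset.sum_comm, ← Finset.sum_div, mul_div_assoc]
    _ ≤ ζ ^ 2 * c ^ 2 := by gcongr
    _ = _ := by ring

/-- Induction on time, carried for all `r ≤ t` because each update reads the whole history. One
update composes Lipschitz maps with the marginal, which is Lipschitz in both the tensor and its
argument. The constant depends neither on `N` nor on the start. -/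
theorem exists_rms_ampIterate_sub_le (p : ℕ) (hp : 0 < p) (hM : 0 ≤ M) (hζ : 0 ≤ ζ)
    (hfF : AMPAssumption M ζ T f F) {s : ℝ} (hs : 0 ≤ s) (t : ℕ) (ht : t ≤ T) :
    ∃ C : ℝ, 0 ≤ C ∧ ∀ (N : ℕ), 0 < N → ∀ (A B : Tensor p N) (δ : ℝ), 0 ≤ δ → InjBound B s →
      InjBound (A - B) δ → ∀ U0 ∈ box M N, ∀ r ≤ t,
        rms (ampIterate M f F A U0 r - ampIterate M f F B U0 r) ≤ C * δ := by
  induction t with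
  | zero =>
    refine ⟨0, le_rfl, fun N hN A B δ hδ hB hAB U0 hU0 r hr => ?_⟩
    rw [Nat.le_zero.1 hr, ampIterate, ampIterate]
    simp
  | succ t ih =>
    obtain ⟨C, hC, ih⟩ := ih (by omega)
    obtain ⟨hf0, hf, hF⟩ := hfF (t + 1) (by omega) ht
    -- Bounds the arguments of the marginal, using `f_t(0) = 0` and `√(t+1) ≤ t+1`; the summand 1
    -- provides `1 ≤ R`.
    set R : ℝ := 1 + ζ * ((t + 1) * M)
    have hR : 1 ≤ R := le_add_of_nonneg_right (by positivity)
    set K : ℝ := (t + 1) * C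
    have hK : 0 ≤ K := by positivity
    set E : ℝ := R ^ p + s * p * R ^ (p - 1) * (ζ * K)
    have hE : 0 ≤ E := by positivity
    refine ⟨C + ζ * (E + K), by positivity, fun N hN A B δ hδ hB hAB U0 hU0 r hr => ?_⟩
    rcases Nat.lt_or_ge t r with htr | htr
    swap
    · refine (ih N hN A B δ hδ hB hAB U0 hU0 r htr).trans ?_
      gcongr
      exact le_add_of_nonneg_right (by positivity)
    obtain rfl : r = t + 1 := by omega
    have ih' := fun r : Fin (t + 1) => ih N hN A B δ hδ hB hAB U0 hU0 r (by omega)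
    have hboxA := ampIterate_mem_box (f := f) (F := F) hM A hU0
    have hboxB := ampIterate_mem_box (f := f) (F := F) hM B hU0
    have hsum : ∑ r : Fin (t + 1), rms (ampIterate M f F A U0 r - ampIterate M f F B U0 r) ^ 2 ≤
        (K * δ) ^ 2 := by
      calc _ ≤ ∑ _r : Fin (t + 1), (C * δ) ^ 2 :=
            Finset.sum_le_sum fun r _ => pow_le_pow_left₀ (rms_nonneg _) (ih' r) 2
        _ = (t + 1) * (C * δ) ^ 2 := by simp
        _ ≤ (t + 1) ^ 2 * (C * δ) ^ 2 := by
          gcongr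
          nlinarith [(Nat.cast_nonneg t : (0 : ℝ) ≤ t)]
        _ = _ := by simp only [K]; ring
    have hcol : ∀ (A : Tensor p N) i, (∀ t, ampIterate M f F A U0 t ∈ box M N) →
        (fun r : Fin (t + 1) => ampIterate M f F A U0 r i) ∈ box M (t + 1) :=
      fun A i h r => h r i
    have hbound : ∀ A : Tensor p N, (∀ t, ampIterate M f F A U0 t ∈ box M N) →
        rms (fun i => f (t + 1) fun r : Fin (t + 1) => ampIterate M f F A U0 r i) ≤ R := by
      intro A h
      refine rms_le_of_forall_abs_le (by linarith) fun i => ?_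
      have h1 := hf _ (hcol A i h) 0 (fun _ => by simpa using hM)
      rw [hf0, sub_zero, sub_zero] at h1
      refine h1.trans (le_add_of_nonneg_of_le zero_le_one ?_)
      gcongr
      refine Real.sqrt_le_iff.2 ⟨by positivity, ?_⟩
      calc _ ≤ ∑ _r : Fin (t + 1), M ^ 2 := Finset.sum_le_sum fun r _ =>
            sq_le_sq' (hcol A i h r).1 (hcol A i h r).2
        _ = (t + 1) * M ^ 2 := by simp
        _ ≤ (t + 1) ^ 2 * M ^ 2 := by
          gcongr
          nlinarith [(Nat.cast_nonneg t : (0 : ℝ) ≤ t)]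
        _ = _ := by ring
    have hw : rms ((fun i => f (t + 1) fun r : Fin (t + 1) => ampIterate M f F A U0 r i) -
        fun i => f (t + 1) fun r : Fin (t + 1) => ampIterate M f F B U0 r i) ≤ ζ * (K * δ) :=
      rms_le_of_forall_sq_le hζ (by positivity) hsum fun i =>
        hf _ (hcol A i hboxA) _ (hcol B i hboxB)
    have hm := rms_marginal_sub_le hN hp hs hδ hB hAB hR (by positivity) (hbound A hboxA)
      (hbound B hboxB) hw
    have hm' : rms (marginal A (fun i => f (t + 1) fun r : Fin (t + 1) => ampIterate M f F A U0 r i)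
        - marginal B fun i => f (t + 1) fun r : Fin (t + 1) => ampIterate M f F B U0 r i) ≤
          E * δ := by
      refine hm.trans (le_of_eq ?_)
      simp only [E]
      ring
    have hfin : rms (ampIterate M f F A U0 (t + 1) - ampIterate M f F B U0 (t + 1)) ≤
        ζ * ((E + K) * δ) := by
      -- The index `none` carries the marginal, and `some r` carries the iterate at time `r`.
      refine rms_le_of_forall_sq_le (ι := Option (Fin (t + 1)))
        (w := fun o => o.elim
          (marginal A (fun i => f (t + 1) fun r : Fin (t + 1) => ampIterate M f F A U0 r i) -
            marginal B fun i => f (t + 1) fun r : Fin (t + 1) => ampIterate M f F B U0 r i)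
          fun r => ampIterate M f F A U0 r - ampIterate M f F B U0 r)
        hζ (by positivity) ?_ fun i => ?_
      · rw [Fintype.sum_option]
        simp only [Option.elim_none, Option.elim_some]
        have := pow_le_pow_left₀ (rms_nonneg _) hm' 2
        have h3 : 0 ≤ E * δ * (K * δ) := by positivity
        nlinarith
      · rw [Fintype.sum_option]
        rw [Pi.sub_apply, ampIterate, ampIterate]
        refine (abs_trunc_sub_le _ _ _).trans ?_
        exact hF _ _ _ (hcol A i hboxA) _ (hcol B i hboxB)
    refine hfin.trans ?_
    rw [← mul_assoc]
    gcongr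
    exact le_add_of_nonneg_left hC

theorem exists_rms_ampOutput_sub_le (p : ℕ) (hp : 0 < p) (hM : 0 ≤ M) (hζ : 0 ≤ ζ)
    (hfF : AMPAssumption M ζ T f F) {s : ℝ} (hs : 0 ≤ s) :
    ∃ C : ℝ, 0 ≤ C ∧ ∀ (N : ℕ), 0 < N → ∀ (A B : Tensor p N) (δ : ℝ), 0 ≤ δ → InjBound B s →
      InjBound (A - B) δ → ∀ U0 ∈ box M N,
        rms (ampOutput M f F T A U0 - ampOutput M f F T B U0) ≤ C * δ := by
  obtain ⟨C, hC, h⟩ := exists_rms_ampIterate_sub_le p hp hM hζ hfF hs T le_rfl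
  refine ⟨C, hC, fun N hN A B δ hδ hB hAB U0 hU0 => ?_⟩
  exact (rms_le_rms fun i => abs_trunc_sub_le _ _ _).trans
    (h N hN A B δ hδ hB hAB U0 hU0 T le_rfl)

end AMP

/-! ### Rotation invariance of the law of the couplings -/

theorem map_gaussianReal_prod_rotation (v : ℝ≥0) {a b : ℝ} (hab : a ^ 2 + b ^ 2 = 1) :
    ((gaussianReal 0 v).prod (gaussianReal 0 v)).map (fun z : ℝ × ℝ => a * z.1 + b * z.2) =
      gaussianReal 0 v := by
  have h1 : (fun z : ℝ × ℝ => a * z.1 + b * z.2) =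
      (fun z : ℝ × ℝ => z.1 + z.2) ∘ Prod.map (fun x => a * x) fun y => b * y := rfl
  rw [h1, ← Measure.map_map (by fun_prop) (by fun_prop), ← Measure.map_prod_map _ _ (by fun_prop)
    (by fun_prop), gaussianReal_map_const_mul, gaussianReal_map_const_mul]
  refine gaussianReal_conv_gaussianReal.trans ?_
  congr 1
  · simp
  · ext
    rw [NNReal.coe_add, NNReal.coe_mul, NNReal.coe_mul]
    change a ^ 2 * (v : ℝ) + b ^ 2 * v = v
    rw [← add_mul, hab, one_mul]

/-- Rotation invariance in each coordinate separately. It transfers every estimate for a single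
tensor to each point of the rotation path. -/
theorem map_couplingLaw_prod_rotation {a b : ℝ} (hab : a ^ 2 + b ^ 2 = 1) :
    ((couplingLaw p N).prod (couplingLaw p N)).map
      (fun AA : Tensor p N × Tensor p N => a • AA.1 + b • AA.2) = couplingLaw p N := by
  have hmp := measurePreserving_arrowProdEquivProdArrow ℝ ℝ (Fin p → Fin N)
    (fun _ => gaussianReal 0 (1 / (N : ℝ≥0) ^ (p - 1)))
    (fun _ => gaussianReal 0 (1 / (N : ℝ≥0) ^ (p - 1)))
  rw [couplingLaw, ← hmp.map_eq, Measure.map_map (by fun_prop) hmp.measurable]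
  have e : (fun AA : Tensor p N × Tensor p N => a • AA.1 + b • AA.2) ∘
      (MeasurableEquiv.arrowProdEquivProdArrow ℝ ℝ (Fin p → Fin N)) =
      fun x i => a * (x i).1 + b * (x i).2 := rfl
  have hI : ∀ _ : Fin p → Fin N, SigmaFinite (((gaussianReal 0 (1 / (N : ℝ≥0) ^ (p - 1))).prod
      (gaussianReal 0 (1 / (N : ℝ≥0) ^ (p - 1)))).map fun z : ℝ × ℝ => a * z.1 + b * z.2) := by
    intro _
    rw [map_gaussianReal_prod_rotation _ hab]
    infer_instance
  rw [e]
  refine (Measure.pi_map_pi (f := fun (_ : Fin p → Fin N) (z : ℝ × ℝ) => a * z.1 + b * z.2)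
    fun _ => by fun_prop).trans ?_
  simp_rw [map_gaussianReal_prod_rotation _ hab]

/-! ### Concentration of the ground state -/

theorem abs_groundState_le (A : Tensor p N) : |groundState A| ≤ (∑ i, |A i|) / N := by
  rw [groundState, abs_div, Nat.abs_cast]
  gcongr
  refine abs_le.2 ⟨le_infOn binaryCube_nonempty fun u hu =>
    neg_le_of_abs_le (abs_eval_le_sum (binaryCube_subset_hilbertCube hu)), ?_⟩
  obtain ⟨u, hu⟩ := binaryCube_nonempty (N := N)
  exact (infOn_le A binaryCube_subset_hilbertCube hu).trans
    ((le_abs_self _).trans (abs_eval_le_sum (binaryCube_subset_hilbertCube hu)))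

theorem continuous_groundState (hN : 0 < N) :
    Continuous (groundState : Tensor p N → ℝ) := by
  refine continuous_iff_continuousAt.2 fun A => ?_
  rw [ContinuousAt, tendsto_iff_norm_sub_tendsto_zero]
  have hc : Continuous fun B : Tensor p N => √(N ^ p) / N * √(∑ i, (B i - A i) ^ 2) := by fun_prop
  refine squeeze_zero (fun _ => norm_nonneg _) (fun B => ?_) (by simpa using hc.tendsto A)
  rw [Real.norm_eq_abs, abs_le']
  refine ⟨groundState_sub_le hN B A, ?_⟩
  have := groundState_sub_le hN A B
  simp_rw [neg_sub, sub_sq_comm (B _)]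
  exact this

theorem integrable_groundState (hN : 0 < N) :
    Integrable (groundState : Tensor p N → ℝ) (couplingLaw p N) := by
  have h : Integrable (fun A : Tensor p N => (∑ i, |A i|) / N) (couplingLaw p N) :=
    (integrable_finsetSum _ fun i _ => (integrable_coupling i).abs).div_const _
  exact h.mono' (continuous_groundState hN).aestronglyMeasurable
    (ae_of_all _ fun A => abs_groundState_le A)

/-- The squared Lipschitz constant `N^{p-2}` times the variance `N^{-(p-1)}` is `1/N`, so deviations
of order one are exponentially unlikely in `N`. -/
theorem couplingLaw_lipschitz_le (hN : 0 < N) (hp : 0 < p) {F : Tensor p N → ℝ} (hF : Measurable F)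
    (hFi : Integrable F (couplingLaw p N))
    (hlip : ∀ A B, F A - F B ≤ √(N ^ p) / N * √(∑ i, (A i - B i) ^ 2)) {t : ℝ} (ht : 0 ≤ t) :
    couplingLaw p N {A | (∫ B, F B ∂(couplingLaw p N)) + t ≤ F A} ≤
      ENNReal.ofReal (Real.exp (-(t ^ 2 / 4 * N))) := by
  have hN' : (0 : ℝ) < N := by exact_mod_cast hN
  refine (pi_gaussianReal_lipschitz_le (couplingVariance_ne_zero (p := p) hN) hF hFi
    (by positivity) hlip ht).trans (le_of_eq ?_)
  congr 3
  rw [div_pow, Real.sq_sqrt (by positivity)]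
  push_cast
  obtain ⟨q, rfl⟩ : ∃ q, p = q + 1 := ⟨p - 1, by omega⟩
  simp only [Nat.add_one_sub_one]
  field_simp
  ring

theorem couplingLaw_groundState_ge_le (hN : 0 < N) (hp : 0 < p) {t : ℝ} (ht : 0 ≤ t) :
    couplingLaw p N {A | meanGroundState p N + t ≤ groundState A} ≤
      ENNReal.ofReal (Real.exp (-(t ^ 2 / 4 * N))) :=
  couplingLaw_lipschitz_le hN hp (continuous_groundState hN).measurable (integrable_groundState hN)
    (groundState_sub_le hN) ht

theorem couplingLaw_groundState_le_le (hN : 0 < N) (hp : 0 < p) {t : ℝ} (ht : 0 ≤ t) :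
    couplingLaw p N {A | groundState A ≤ meanGroundState p N - t} ≤
      ENNReal.ofReal (Real.exp (-(t ^ 2 / 4 * N))) := by
  have := couplingLaw_lipschitz_le hN hp (continuous_groundState hN).measurable.neg
    (integrable_groundState hN).neg (fun A B => by
      have := groundState_sub_le hN B A
      simp_rw [sub_sq_comm (B _)] at this
      simp only [Pi.neg_apply]
      linarith) ht
  refine (measure_mono fun A hA => ?_).trans this
  have hA' : groundState A ≤ meanGroundState p N - t := hA
  simp only [Set.mem_ofPred_eq, Pi.neg_apply, integral_neg]
  rw [meanGroundState] at hA'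
  linarith

/-! ### Rounding from the solid cube to the binary cube -/

/-- The sign in `{-1, 1}` encoded by a Boolean. -/
def boolSign (b : Bool) : ℝ := if b then 1 else -1

/-- The probability of `b` under the product measure on `{-1,1}^N` with mean `u`. -/
noncomputable def signWeight (u : Fin N → ℝ) (b : Fin N → Bool) : ℝ :=
  ∏ j, (1 + boolSign (b j) * u j) / 2

theorem abs_boolSign (b : Bool) : |boolSign b| = 1 := by cases b <;> simp [boolSign]

theorem boolSign_mem_binaryCube (b : Fin N → Bool) : (fun j => boolSign (b j)) ∈ binaryCube N := by
  intro j
  cases h : b j <;> simp [boolSign, h]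

theorem signWeight_nonneg {u : Fin N → ℝ} (hu : u ∈ hilbertCube N) (b : Fin N → Bool) :
    0 ≤ signWeight u b := by
  refine Finset.prod_nonneg fun j _ => ?_
  obtain ⟨h1, h2⟩ := hu j
  cases b j <;> simp [boolSign] <;> linarith

theorem sum_signWeight_mul (u : Fin N → ℝ) (g : Fin N → Bool → ℝ) :
    ∑ b : Fin N → Bool, signWeight u b * ∏ j, g j (b j) =
      ∏ j, ((1 + u j) / 2 * g j true + (1 - u j) / 2 * g j false) := by
  have h := Finset.prod_univ_sum (fun _ : Fin N => (Finset.univ : Finset Bool))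
    fun j β => (1 + boolSign β * u j) / 2 * g j β
  rw [Fintype.piFinset_univ] at h
  simp_rw [signWeight, ← Finset.prod_mul_distrib]
  rw [← h]
  refine Finset.prod_congr rfl fun j _ => ?_
  simp only [boolSign, Fintype.sum_bool, if_true, Bool.false_eq_true, if_false]
  ring

theorem sum_signWeight (u : Fin N → ℝ) : ∑ b : Fin N → Bool, signWeight u b = 1 := by
  have := sum_signWeight_mul u fun _ _ => 1
  simp only [Finset.prod_const_one, mul_one] at this
  rw [this]
  exact Finset.prod_eq_one fun j _ => by ring

/-- The expectation of `σ_{i₁} ⋯ σ_{i_p}` under the product measure on `{-1,1}^N` with mean `u`. -/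
noncomputable def signMoment (u : Fin N → ℝ) (i : Fin p → Fin N) : ℝ :=
  ∑ b : Fin N → Bool, signWeight u b * ∏ k, boolSign (b (i k))

theorem abs_signMoment_le {u : Fin N → ℝ} (hu : u ∈ hilbertCube N) (i : Fin p → Fin N) :
    |signMoment u i| ≤ 1 := by
  rw [← sum_signWeight u]
  refine (Finset.abs_sum_le_sum_abs _ _).trans (Finset.sum_le_sum fun b _ => ?_)
  rw [abs_mul, Finset.abs_prod, abs_of_nonneg (signWeight_nonneg hu b)]
  simp [abs_boolSign]

/-- Distinct coordinates are independent with means `u j`, so the moment factorizes; only indices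
with repetitions deviate from the product. -/
theorem signMoment_of_injective (u : Fin N → ℝ) {i : Fin p → Fin N} (hi : Function.Injective i) :
    signMoment u i = ∏ k, u (i k) := by
  classical
  have h1 : ∀ w : Fin N → ℝ, ∏ k, w (i k) = ∏ j, if j ∈ Finset.univ.image i then w j else 1 := by
    intro w
    rw [Finset.prod_ite_mem, Finset.univ_inter, Finset.prod_image fun a _ b _ h => hi h]
  rw [signMoment, h1 u]
  refine (Finset.sum_congr rfl fun b _ => congrArg (signWeight u b * ·)
    (h1 fun j => boolSign (b j))).trans ((sum_signWeight_mul u fun j β =>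
      if j ∈ Finset.univ.image i then boolSign β else 1).trans ?_)
  refine Finset.prod_congr rfl fun j _ => ?_
  split_ifs
  · simp [boolSign]
    ring
  · ring

/-- The minimum over signs is at most the average of `A(σ)` over independent signs with mean `u`. -/
theorem infOn_binaryCube_le_sum {u : Fin N → ℝ} (hu : u ∈ hilbertCube N) (A : Tensor p N) :
    infOn A (binaryCube N) ≤ ∑ i, A i * signMoment u i := by
  have h1 : ∑ i, A i * signMoment u i =
      ∑ b : Fin N → Bool, signWeight u b * eval A fun j => boolSign (b j) := by
    simp_rw [signMoment, eval, Finset.mul_sum]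
    rw [Finset.sum_comm]
    exact Finset.sum_congr rfl fun _ _ => Finset.sum_congr rfl fun _ _ => by ring
  calc infOn A (binaryCube N)
      = ∑ b : Fin N → Bool, signWeight u b * infOn A (binaryCube N) := by
        rw [← Finset.sum_mul, sum_signWeight, one_mul]
    _ ≤ _ := by
        rw [h1]
        exact Finset.sum_le_sum fun b _ => mul_le_mul_of_nonneg_left
          (infOn_le A binaryCube_subset_hilbertCube (boolSign_mem_binaryCube b))
          (signWeight_nonneg hu b)

theorem card_not_injective_le (p N : ℕ) :
    (Finset.univ.filter fun i : Fin p → Fin N => ¬ Function.Injective i).card ≤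
      p ^ 2 * N ^ (p - 1) := by
  classical
  have hsub : (Finset.univ.filter fun i : Fin p → Fin N => ¬ Function.Injective i) ⊆
      (Finset.univ.filter fun ab : Fin p × Fin p => ab.1 ≠ ab.2).biUnion fun ab =>
        Finset.univ.filter fun i : Fin p → Fin N => i ab.1 = i ab.2 := by
    intro i hi
    simp only [Finset.mem_filter, Finset.mem_univ, true_and, Function.Injective, not_forall] at hi
    obtain ⟨a, b, hab, hne⟩ := hi
    simp only [Finset.mem_biUnion, Finset.mem_filter, Finset.mem_univ, true_and]
    exact ⟨(a, b), hne, hab⟩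
  refine (Finset.card_le_card hsub).trans ?_
  have h1 : ∀ ab ∈ Finset.univ.filter fun ab : Fin p × Fin p => ab.1 ≠ ab.2,
      (Finset.univ.filter fun i : Fin p → Fin N => i ab.1 = i ab.2).card ≤ N ^ (p - 1) := by
    rintro ⟨a, b⟩ hab
    simp only [Finset.mem_filter, Finset.mem_univ, true_and] at hab
    have hc : Fintype.card ({k : Fin p // k ≠ b} → Fin N) = N ^ (p - 1) := by simp
    rw [← hc, ← Finset.card_univ]
    -- When `i a = i b`, the index is determined by its values away from `b`.
    refine Finset.card_le_card_of_injOn (fun i k => i k) (fun _ _ => Finset.mem_coe.2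
      (Finset.mem_univ _)) ?_
    intro i hi i' hi' h
    simp only [Finset.coe_filter, Finset.mem_univ, true_and, Set.mem_ofPred_eq] at hi hi'
    funext k
    by_cases hk : k = b
    · subst hk
      rw [← hi, ← hi']
      exact congrFun h ⟨a, hab⟩
    · exact congrFun h ⟨k, hk⟩
  refine (Finset.card_biUnion_le_card_mul _ _ _ h1).trans ?_
  gcongr
  refine (Finset.card_filter_le _ _).trans ?_
  simp [sq]

theorem sum_sq_signMoment_sub_le {u : Fin N → ℝ} (hu : u ∈ hilbertCube N) :
    ∑ i : Fin p → Fin N, (signMoment u i - ∏ k, u (i k)) ^ 2 ≤ 4 * (p ^ 2 * N ^ (p - 1)) := by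
  classical
  have h1 : ∀ i : Fin p → Fin N, (signMoment u i - ∏ k, u (i k)) ^ 2 ≤
      if ¬ Function.Injective i then 4 else 0 := by
    intro i
    split_ifs with hi
    · rw [signMoment_of_injective u hi]
      simp
    · have h2 := abs_le.1 (abs_signMoment_le hu i)
      have h3 : |∏ k, u (i k)| ≤ 1 := by
        rw [Finset.abs_prod]
        exact Finset.prod_le_one (fun _ _ => abs_nonneg _) fun k _ => abs_le.2 (hu _)
      have h4 := abs_le.1 h3
      nlinarith
  refine (Finset.sum_le_sum fun i _ => h1 i).trans ?_
  rw [← Finset.sum_filter, Finset.sum_const, nsmul_eq_mul, mul_comm]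
  gcongr
  exact_mod_cast card_not_injective_le p N

/-- For fixed `u`, the average of `A(σ)` over independent signs with mean `u` differs from `A(u)` by
a Gaussian linear functional supported on indices with repetitions. Its variance is of order one, so
a deviation of order `N` has probability `e^{-aN²}`, which beats the `(2m+1)^N` points of a grid of
mesh `1/m`. The injective norm bound passes from the grid to the whole cube. -/
theorem eventually_infOn_binaryCube_le (hp : 0 < p) {ε : ℝ} (hε : 0 < ε) :
    ∀ᶠ N : ℕ in atTop, couplingLaw p N
      {A | ¬ infOn A (binaryCube N) ≤ infOn A (hilbertCube N) + ε * N} ≤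
        ENNReal.ofReal (2 * Real.exp (-N)) := by
  obtain ⟨s, hs1, hs⟩ := exists_couplingLaw_not_injBound_le hp
  obtain ⟨m, hm⟩ := exists_nat_ge (2 * (s * p) / ε + 1)
  have hp' : (0 : ℝ) < p := by exact_mod_cast hp
  have hm0 : (0 : ℝ) < m := lt_of_lt_of_le (by positivity) hm
  have hms : s * p / m ≤ ε / 2 := by
    rw [div_le_iff₀ hm0]
    have : 2 * (s * p) / ε ≤ m := by linarith
    rw [div_le_iff₀ hε] at this
    linarith
  set a := ε ^ 2 / (64 * p ^ 2) with ha
  have ha0 : 0 < a := by positivity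
  have hl0 : 0 ≤ Real.log (2 * m + 1) := Real.log_nonneg (by linarith)
  obtain ⟨n, hn⟩ := exists_nat_ge ((Real.log (2 * m + 1) + 1) / a + 1)
  filter_upwards [eventually_ge_atTop n] with N hnN
  have hNn : (Real.log (2 * m + 1) + 1) / a + 1 ≤ N := hn.trans (by exact_mod_cast hnN)
  have hN' : (0 : ℝ) < N := lt_of_lt_of_le (by positivity) hNn
  have hN : 0 < N := by exact_mod_cast hN'
  set G : Finset (Fin N → ℤ) := Fintype.piFinset fun _ => Finset.Icc (-(m : ℤ)) m
  set g : (Fin N → ℤ) → Fin N → ℝ := fun z j => z j / m with hg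
  have hgH : ∀ z ∈ G, g z ∈ hilbertCube N := by
    intro z hz j
    have := Finset.mem_Icc.1 (Fintype.mem_piFinset.1 hz j)
    have h1 : -(m : ℝ) ≤ z j := by exact_mod_cast this.1
    have h2 : (z j : ℝ) ≤ m := by exact_mod_cast this.2
    simp only [hg, Set.mem_Icc]
    rw [le_div_iff₀ hm0, div_le_iff₀ hm0]
    constructor <;> linarith
  have hsub : {A : Tensor p N | ¬ infOn A (binaryCube N) ≤ infOn A (hilbertCube N) + ε * N} ⊆
      {A | ¬ InjBound A s} ∪ ⋃ z ∈ G, {A : Tensor p N | ε / 2 * N ≤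
        ∑ i, A i * (signMoment (g z) i - ∏ k, g z (i k))} := by
    intro A hA
    by_contra hcon
    rw [Set.mem_union, not_or] at hcon
    obtain ⟨hK, hG⟩ := hcon
    have hK' : InjBound A s := not_not.1 hK
    refine hA ?_
    rw [← sub_le_iff_le_add]
    refine le_infOn hilbertCube_nonempty fun u hu => ?_
    set z : Fin N → ℤ := fun j => ⌊u j * m⌋ with hz
    have hzG : z ∈ G := by
      refine Fintype.mem_piFinset.2 fun j => Finset.mem_Icc.2 ⟨?_, ?_⟩
      · refine Int.le_floor.2 ?_
        push_cast
        nlinarith [(hu j).1]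
      · have : (⌊u j * m⌋ : ℝ) ≤ m := (Int.floor_le _).trans (by nlinarith [(hu j).2])
        exact_mod_cast this
    have h1 : ∑ i, A i * (signMoment (g z) i - ∏ k, g z (i k)) < ε / 2 * N := by
      by_contra hlt
      exact hG (Set.mem_biUnion hzG (not_lt.1 hlt))
    simp_rw [mul_sub] at h1
    rw [Finset.sum_sub_distrib] at h1
    change _ - eval A (g z) < _ at h1
    have h2 := infOn_binaryCube_le_sum (hgH z hzG) A
    have hd : rms (g z - u) ≤ (m : ℝ)⁻¹ := by
      refine rms_le_of_forall_abs_le (by positivity) fun j => ?_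
      have h3 := Int.floor_le (u j * m)
      have h4 := Int.lt_floor_add_one (u j * m)
      have h5 : (g z - u) j = (⌊u j * m⌋ - u j * m) / m := by
        simp only [hg, hz, Pi.sub_apply]
        field_simp
      rw [h5, abs_div, abs_of_pos hm0, ← one_div]
      gcongr
      exact abs_le.2 ⟨by linarith, by linarith⟩
    have h6 := form_sub_form_le hN (zero_le_one.trans hs1) hK' (x := fun _ => g z)
      (y := fun _ => u) zero_le_one (by positivity)
      (fun _ => rms_le_one_of_mem_hilbertCube (hgH z hzG))
      (fun _ => rms_le_one_of_mem_hilbertCube hu) fun _ => hd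
    rw [← eval_eq_form, ← eval_eq_form, one_pow, mul_one, ← div_eq_mul_inv] at h6
    have h7 : s * p / m * N ≤ ε / 2 * N := by gcongr
    have h8 := le_abs_self (eval A (g z) - eval A u)
    linarith
  refine (measure_mono hsub).trans ((measure_union_le _ _).trans ?_)
  rw [two_mul, ENNReal.ofReal_add (Real.exp_pos _).le (Real.exp_pos _).le]
  refine add_le_add (hs N hN) ((measure_biUnion_finset_le _ _).trans ?_)
  have hterm : ∀ z ∈ G, couplingLaw p N {A : Tensor p N | ε / 2 * N ≤
      ∑ i, A i * (signMoment (g z) i - ∏ k, g z (i k))} ≤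
        ENNReal.ofReal (Real.exp (-(a * N ^ 2))) := by
    intro z hz
    refine (couplingLaw_linear_le hN _ (by positivity) (sum_sq_signMoment_sub_le (hgH z hz))
      (by positivity)).trans ?_
    refine ENNReal.ofReal_le_ofReal (Real.exp_le_exp.2 (le_of_eq ?_))
    rw [ha]
    field_simp
    ring
  refine (Finset.sum_le_sum hterm).trans ?_
  rw [Finset.sum_const, nsmul_eq_mul, ← ENNReal.ofReal_natCast,
    ← ENNReal.ofReal_mul (Nat.cast_nonneg _)]
  refine ENNReal.ofReal_le_ofReal ?_
  have hcard : (G.card : ℝ) = Real.exp (Real.log (2 * m + 1) * N) := by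
    have h1 : G.card = (2 * m + 1) ^ N := by
      simp only [G, Fintype.card_piFinset, Int.card_Icc, Finset.prod_const, Finset.card_univ,
        Fintype.card_fin]
      congr 1
      omega
    rw [h1, mul_comm (Real.log _), Real.exp_nat_mul, Real.exp_log (by positivity)]
    push_cast
    rfl
  rw [hcard, ← Real.exp_add]
  refine Real.exp_le_exp.2 ?_
  have h9 : Real.log (2 * m + 1) + 1 ≤ a * N := by
    have : (Real.log (2 * m + 1) + 1) / a ≤ N := by linarith
    rw [div_le_iff₀ ha0] at this
    linarith
  nlinarith

/-! ### Outer measure estimates -/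

/-- Only monotonicity of outer measure is used, so neither set has to be measurable. -/
theorem exists_mem_notMem_of_measure_le {α : Type*} [MeasurableSpace α] {P : Measure α}
    {E G : Set α} {x y : ℝ} (hE : 1 - x ≤ P.real E) (hG : P G ≤ ENNReal.ofReal y) (hy : 0 ≤ y)
    (hxy : x + y < 1) : ∃ z ∈ E, z ∉ G := by
  by_contra! hcon
  have h1 : P.real E ≤ y := ENNReal.toReal_le_of_le_ofReal hy ((measure_mono hcon).trans hG)
  linarith

theorem measure_compl_le_of_subset {α : Type*} [MeasurableSpace α] {P : Measure α}
    [IsProbabilityMeasure P] {E E' : Set α} (hE' : MeasurableSet E') (hsub : E ⊆ E') {x : ℝ}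
    (hE : 1 - x ≤ P.real E) : P E'ᶜ ≤ ENNReal.ofReal x := by
  have h1 : P.real E ≤ P.real E' := measureReal_mono hsub
  have h2 := probReal_compl_eq_one_sub (μ := P) hE'
  rw [← ofReal_measureReal]
  exact ENNReal.ofReal_le_ofReal (by linarith)

/-- Fubini applied to a measurable hull of `E`, whose sections contain those of `E`; measurability
of `E` is not required. -/
theorem one_sub_le_prod_real {α β : Type*} [MeasurableSpace α] [MeasurableSpace β] {μ : Measure α}
    {ν : Measure β} [IsProbabilityMeasure μ] [IsProbabilityMeasure ν] {E : Set (α × β)} {x : ℝ}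
    (hx : 0 ≤ x) (h : ∀ᵐ y ∂ν, μ {a | (a, y) ∉ E} ≤ ENNReal.ofReal x) : 1 - x ≤ (μ.prod ν).real E := by
  have h1 : ENNReal.ofReal (1 - x) ≤ (μ.prod ν) E := by
    rw [← measure_toMeasurable, Measure.prod_apply_symm (measurableSet_toMeasurable _ _)]
    have h2 : ∀ᵐ y ∂ν, ENNReal.ofReal (1 - x) ≤
        μ ((fun a => (a, y)) ⁻¹' toMeasurable (μ.prod ν) E) := by
      filter_upwards [h] with y hy
      have h3 : (1 : ENNReal) ≤ μ ((fun a => (a, y)) ⁻¹' E) + ENNReal.ofReal x := by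
        rw [← measure_univ (μ := μ), ← Set.union_compl_self ((fun a => (a, y)) ⁻¹' E)]
        exact (measure_union_le _ _).trans (add_le_add le_rfl hy)
      refine le_trans ?_ (measure_mono (Set.preimage_mono (subset_toMeasurable _ _)))
      rw [ENNReal.ofReal_sub _ hx, ENNReal.ofReal_one]
      exact tsub_le_iff_right.2 h3
    calc ENNReal.ofReal (1 - x) = ∫⁻ _, ENNReal.ofReal (1 - x) ∂ν := by simp
      _ ≤ _ := lintegral_mono_ae h2
  exact (ENNReal.ofReal_le_iff_le_toReal (measure_ne_top _ _)).1 h1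

theorem couplingLaw_prod_rotation_le {a b : ℝ} (hab : a ^ 2 + b ^ 2 = 1) (S : Set (Tensor p N)) :
    ((couplingLaw p N).prod (couplingLaw p N)) {AA | a • AA.1 + b • AA.2 ∈ S} ≤
      couplingLaw p N S := by
  have hm : Measurable fun AA : Tensor p N × Tensor p N => a • AA.1 + b • AA.2 := by fun_prop
  rw [← measure_toMeasurable S]
  conv_rhs => rw [← map_couplingLaw_prod_rotation hab,
    Measure.map_apply hm (measurableSet_toMeasurable _ _)]
  exact measure_mono fun AA hAA => subset_toMeasurable _ _ hAA

theorem couplingLaw_far_mul_le (hN : 0 < N) (hp : 0 < p) (B : Set (Tensor p N)) (r : ℝ) :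
    couplingLaw p N {A | ∀ A' ∈ B, r ^ 2 * N ^ 2 / N ^ p ≤ ∑ i, (A i - A' i) ^ 2} *
      couplingLaw p N B ≤ ENNReal.ofReal (Real.exp (-(r ^ 2 / 4 * N))) := by
  have hN' : (0 : ℝ) < N := by exact_mod_cast hN
  set D : ℝ := r ^ 2 * N ^ 2 / N ^ p with hD
  set S := {A : Tensor p N | ∀ A' ∈ B, D ≤ ∑ i, (A i - A' i) ^ 2} with hS
  -- `B` may fail to be measurable; `B'` is a closed set containing it that is still far from `S`.
  set B' := {A' : Tensor p N | ∀ A ∈ S, D ≤ ∑ i, (A i - A' i) ^ 2} with hB'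
  have hSm : MeasurableSet S := by
    have : S = ⋂ A' ∈ B, {A : Tensor p N | D ≤ ∑ i, (A i - A' i) ^ 2} := by ext; simp [hS]
    rw [this]
    exact (isClosed_biInter fun A' _ =>
      isClosed_le continuous_const (by fun_prop)).measurableSet
  have hBm : MeasurableSet B' := by
    have : B' = ⋂ A ∈ S, {A' : Tensor p N | D ≤ ∑ i, (A i - A' i) ^ 2} := by ext; simp [hB']
    rw [this]
    exact (isClosed_biInter fun A' _ =>
      isClosed_le continuous_const (by fun_prop)).measurableSet
  have key := pi_gaussianReal_mul_le (couplingVariance_ne_zero (p := p) hN) hSm hBm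
    fun A hA A' hA' => hA' A hA
  rw [← couplingLaw] at key
  refine (mul_le_mul_right (measure_mono fun A' hA' A hA => hA A' hA') _).trans
    (key.trans (le_of_eq ?_))
  congr 3
  rw [hD]
  push_cast
  obtain ⟨q, rfl⟩ : ∃ q, p = q + 1 := ⟨p - 1, by omega⟩
  simp only [Nat.add_one_sub_one]
  field_simp
  ring

/-- Making the near-optimality conditions strict enlarges the event and makes it closed, so its
complement can be measured. -/
theorem couplingLaw_prod_compl_overlap_le {ε a x : ℝ}
    (h : 1 - x ≤ ((couplingLaw p N).prod (couplingLaw p N)).real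
      {AA | ∀ v₁ ∈ hilbertCube N, ∀ v₂ ∈ hilbertCube N,
        eval AA.1 v₁ / N ≤ a → eval AA.2 v₂ / N ≤ a → |inner v₁ v₂| ≤ ε * N}) :
    ((couplingLaw p N).prod (couplingLaw p N))
      {AA | ∀ v₁ ∈ hilbertCube N, ∀ v₂ ∈ hilbertCube N,
        eval AA.1 v₁ / N < a → eval AA.2 v₂ / N < a → |inner v₁ v₂| ≤ ε * N}ᶜ ≤
      ENNReal.ofReal x := by
  refine measure_compl_le_of_subset (IsClosed.measurableSet ?_) ?_ h
  swap
  · intro AA hAA v₁ h₁ v₂ h₂ h₃ h₄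
    exact hAA v₁ h₁ v₂ h₂ h₃.le h₄.le
  simp only [Set.ofPred_forall]
  refine isClosed_iInter fun v₁ => isClosed_iInter fun _ => isClosed_iInter fun v₂ =>
    isClosed_iInter fun _ => ?_
  have hev : ∀ v : Fin N → ℝ, Continuous fun A : Tensor p N => eval A v := fun v => by
    unfold eval; fun_prop
  exact isClosed_imp (isOpen_lt (((hev v₁).comp continuous_fst).div_const _) continuous_const)
    (isClosed_imp (isOpen_lt (((hev v₂).comp continuous_snd).div_const _) continuous_const)
      isClosed_const)

/-! ### Consequences of the overlap gap -/

theorem eval_smul (c : ℝ) (A : Tensor p N) (u : Fin N → ℝ) :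
    eval A (c • u) = c ^ p * eval A u := by
  simp only [eval, Pi.smul_apply, smul_eq_mul, Finset.prod_mul_distrib, Finset.prod_const,
    Finset.card_univ, Fintype.card_fin, Finset.mul_sum]
  exact Finset.sum_congr rfl fun _ _ => by ring

theorem exists_pos_mul_abs_le {e₁ e₂ g : ℝ} (hg : 0 < g) :
    ∃ c : ℝ, 0 < c ∧ c ≤ 1 ∧ c * |e₁| ≤ g ∧ c * |e₂| ≤ g := by
  refine ⟨min 1 (g / (|e₁| + |e₂| + 1)), lt_min one_pos (by positivity), min_le_left _ _, ?_, ?_⟩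
  all_goals
    refine (mul_le_mul_of_nonneg_right (min_le_right _ _) (abs_nonneg _)).trans ?_
    rw [div_mul_eq_mul_div, div_le_iff₀ (by positivity)]
    gcongr
    linarith [abs_nonneg e₁, abs_nonneg e₂]

/-- Otherwise all sufficiently small multiples of a vector are near optimal, since `A(cu) = c^p
A(u)`. Scaling does not affect overlaps, so two vectors with overlap inside the gap contradict the
property. -/
theorem OverlapGapProperty.infOn_add_le (hp : 0 < p) (hN : 2 ≤ N) {𝒜 : Set (Tensor p N)}
    {μ ν₁ ν₂ : ℝ} (hν₁ : 0 < ν₁) (hν : ν₁ < ν₂) (hν₂ : ν₂ < 1)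
    (h : OverlapGapProperty 𝒜 (hilbertCube N) μ ν₁ ν₂) {A : Tensor p N} (hA : A ∈ 𝒜) :
    infOn A (hilbertCube N) / N + μ ≤ 0 := by
  by_contra! hpos
  have hN' : (0 : ℝ) < N := by exact_mod_cast (by omega : 0 < N)
  set q := (ν₁ + ν₂) / 2 with hq
  have hq0 : 0 < q := by linarith
  have hq1 : q < 1 := by linarith
  set i₀ : Fin N := ⟨0, by omega⟩
  set i₁ : Fin N := ⟨1, by omega⟩
  have hne : i₀ ≠ i₁ := by simp [i₀, i₁, Fin.ext_iff]
  set u₁ : Fin N → ℝ := Pi.single i₀ 1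
  set u₂ : Fin N → ℝ := Pi.single i₀ q + Pi.single i₁ √(1 - q ^ 2)
  have hs : √(1 - q ^ 2) ^ 2 = 1 - q ^ 2 := Real.sq_sqrt (by nlinarith)
  have hs1 : √(1 - q ^ 2) ≤ 1 := Real.sqrt_le_one.2 (by nlinarith)
  have hs0 : 0 ≤ √(1 - q ^ 2) := Real.sqrt_nonneg _
  have h1 : u₁ ∈ hilbertCube N := fun i => by
    simp only [u₁, Pi.single_apply]
    split_ifs <;> norm_num
  have h2 : u₂ ∈ hilbertCube N := fun i => by
    simp only [u₂, Pi.add_apply, Pi.single_apply]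
    rcases eq_or_ne i i₀ with rfl | hi
    · simp only [if_true, hne, if_false, add_zero]
      exact ⟨by linarith, hq1.le⟩
    · simp only [hi, if_false, zero_add]
      split_ifs
      · exact ⟨by linarith, hs1⟩
      · norm_num
  have n1 : norm2 u₁ = 1 := by simp [norm2_eq_norm, u₁]
  have n2 : norm2 u₂ = 1 := by
    have : norm2 u₂ ^ 2 = 1 := by
      rw [norm2_sq]
      have : ∀ i, u₂ i ^ 2 = (Pi.single i₀ (q ^ 2) : Fin N → ℝ) i +
          (Pi.single i₁ (1 - q ^ 2) : Fin N → ℝ) i := by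
        intro i
        simp only [u₂, Pi.add_apply, Pi.single_apply]
        rcases eq_or_ne i i₀ with rfl | hi
        · simp [hne]
        · simp only [hi, if_false, zero_add]
          split_ifs
          · exact hs
          · norm_num
      simp_rw [this, Finset.sum_add_distrib]
      simp
    nlinarith [norm2_nonneg u₂]
  have h12 : inner u₁ u₂ = q := by
    simp [inner, u₁, u₂, Pi.single_apply, hne]
  obtain ⟨c, hc0, hc1, hce₁, hce₂⟩ := exists_pos_mul_abs_le (e₁ := eval A u₁ / N)
    (e₂ := eval A u₂ / N) hpos
  have hmem : ∀ {u : Fin N → ℝ}, u ∈ hilbertCube N → c • u ∈ hilbertCube N := fun hu i => by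
    obtain ⟨ha, hb⟩ := hu i
    simp only [Pi.smul_apply, smul_eq_mul, Set.mem_Icc]
    constructor <;> nlinarith
  have hopt : ∀ {u : Fin N → ℝ}, c * |eval A u / N| ≤ infOn A (hilbertCube N) / N + μ →
      eval A (c • u) / N ≤ infOn A (hilbertCube N) / N + μ := fun hu => by
    rw [eval_smul, mul_div_assoc]
    refine le_trans (le_trans (le_abs_self _) ?_) hu
    rw [abs_mul, abs_of_pos (pow_pos hc0 p)]
    exact mul_le_mul_of_nonneg_right (pow_le_of_le_one hc0.le hc1 hp.ne') (abs_nonneg _)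
  have hn : ∀ u : Fin N → ℝ, norm2 (c • u) = c * norm2 u := fun u => by
    simp only [norm2_eq_norm, WithLp.toLp_smul, norm_smul, Real.norm_eq_abs, abs_of_pos hc0]
  have hi : inner (c • u₁) (c • u₂) = c * c * inner u₁ u₂ := by
    simp only [inner, Pi.smul_apply, smul_eq_mul, Finset.mul_sum]
    exact Finset.sum_congr rfl fun _ _ => by ring
  have key := h A hA A hA _ (hmem h1) _ (hmem h2) (hopt hce₁) (hopt hce₂)
  rw [hi, hn, hn, n1, n2, h12, mul_one, abs_of_pos (by positivity),
    mul_div_cancel_left₀ _ (by positivity)] at key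
  rcases key with ⟨_, hk⟩ | ⟨hk, _⟩ <;> linarith

/-- A discrete intermediate value argument for the overlap with `V 0`, which is 1 at the start. The
lower bound `κ` on the norms makes a short step a small change of the normalized overlap. -/
theorem OverlapGapProperty.false_of_path (hN : 0 < N) {𝒜 : Set (Tensor p N)} {μ ν₁ ν₂ κ d : ℝ}
    (hν₁ : 0 < ν₁) (hν₂ : ν₂ < 1) (hκ : 0 < κ) (hd : 2 * d < (ν₂ - ν₁) * κ)
    (h : OverlapGapProperty 𝒜 (hilbertCube N) μ ν₁ ν₂) {m : ℕ} {A : ℕ → Tensor p N}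
    {V : ℕ → Fin N → ℝ} (hA : ∀ j ≤ m, A j ∈ 𝒜) (hV : ∀ j ≤ m, V j ∈ hilbertCube N)
    (hopt : ∀ j ≤ m, eval (A j) (V j) / N ≤ infOn (A j) (hilbertCube N) / N + μ)
    (hVκ : ∀ j ≤ m, κ ≤ rms (V j)) (hstep : ∀ j < m, rms (V (j + 1) - V j) ≤ d)
    (hend : |inner (V 0) (V m)| ≤ ν₁ * κ ^ 2 * N) (hν : ν₁ < ν₂) : False := by
  have hN' : (0 : ℝ) < N := by exact_mod_cast hN
  have hnn : ∀ u v : Fin N → ℝ, norm2 u * norm2 v = N * (rms u * rms v) := fun u v => by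
    rw [norm2_eq_rms hN, norm2_eq_rms hN]
    calc _ = √(N : ℝ) ^ 2 * (rms u * rms v) := by ring
      _ = _ := by rw [Real.sq_sqrt hN'.le]
  have hpos : ∀ j ≤ m, 0 < rms (V j) := fun j hj => hκ.trans_le (hVκ j hj)
  have hden : ∀ j ≤ m, 0 < N * (rms (V 0) * rms (V j)) := fun j hj =>
    mul_pos hN' (mul_pos (hpos 0 (Nat.zero_le _)) (hpos j hj))
  have hgap : ∀ j ≤ m, |inner (V 0) (V j)| ≤ ν₁ * (N * (rms (V 0) * rms (V j))) ∨
      ν₂ * (N * (rms (V 0) * rms (V j))) ≤ |inner (V 0) (V j)| := by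
    intro j hj
    have := h _ (hA 0 (Nat.zero_le _)) _ (hA j hj) _ (hV 0 (Nat.zero_le _)) _ (hV j hj)
      (hopt 0 (Nat.zero_le _)) (hopt j hj)
    rw [hnn] at this
    rcases this with ⟨_, hk⟩ | ⟨hk, _⟩
    · exact Or.inl ((div_le_iff₀ (hden j hj)).1 hk)
    · exact Or.inr ((le_div_iff₀ (hden j hj)).1 hk)
  have main : ∀ j ≤ m, ν₂ * (N * (rms (V 0) * rms (V j))) ≤ |inner (V 0) (V j)| := by
    intro j
    induction j with
    | zero =>
      intro _
      have : inner (V 0) (V 0) = N * (rms (V 0) * rms (V 0)) := by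
        rw [← sq, rms_sq, inner]
        field_simp
      rw [this, abs_of_pos (hden 0 (Nat.zero_le _))]
      exact mul_le_of_le_one_left (hden 0 (Nat.zero_le _)).le hν₂.le
    | succ j ih =>
      intro hj
      refine (hgap (j + 1) hj).resolve_left fun hlow => ?_
      have ih' := ih (by omega)
      have e : inner (V 0) (V (j + 1)) - inner (V 0) (V j) = inner (V 0) (V (j + 1) - V j) := by
        simp [inner, mul_sub, Finset.sum_sub_distrib]
      have hdiff := abs_inner_le hN (V 0) (V (j + 1) - V j)
      rw [← e] at hdiff
      have h1 : |inner (V 0) (V j)| - |inner (V 0) (V (j + 1))| ≤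
          |inner (V 0) (V (j + 1)) - inner (V 0) (V j)| := by
        rw [abs_sub_comm]
        exact abs_sub_abs_le_abs_sub _ _
      have hr : rms (V (j + 1)) ≤ rms (V j) + d := by
        have := rms_add_le (V j) (V (j + 1) - V j)
        rw [add_sub_cancel] at this
        linarith [hstep j (by omega)]
      -- A jump across the gap would give `ν₂ rms (V j) ≤ ν₁ (rms (V j) + d) + d`, hence `(ν₂ - ν₁)
      -- κ ≤ 2d`.
      have h2 : N * rms (V 0) * (ν₂ * rms (V j)) ≤
          N * rms (V 0) * (ν₁ * rms (V (j + 1)) + rms (V (j + 1) - V j)) := by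
        nlinarith
      have h3 := le_of_mul_le_mul_left h2 (mul_pos hN' (hpos 0 (Nat.zero_le _)))
      have h4 := hstep j (by omega)
      have h5 := hVκ j (by omega)
      have hd0 : 0 ≤ d := (rms_nonneg _).trans h4
      nlinarith
  have h6 := main m le_rfl
  have h7 : ν₁ * κ ^ 2 * N < ν₂ * (N * (rms (V 0) * rms (V m))) := by
    have h8 : κ ^ 2 ≤ rms (V 0) * rms (V m) := by
      rw [sq]
      exact mul_le_mul (hVκ 0 (Nat.zero_le _)) (hVκ m le_rfl) hκ.le (rms_nonneg _)
    have h9 : 0 < κ ^ 2 * N := by positivity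
    calc ν₁ * κ ^ 2 * N = ν₁ * (κ ^ 2 * N) := by ring
      _ < ν₂ * (κ ^ 2 * N) := by gcongr
      _ ≤ ν₂ * (rms (V 0) * rms (V m) * N) := by gcongr; linarith
      _ = _ := by ring
  linarith

/-! ### Near optimality along a rotation path -/

theorem eventually_exp_neg_mul_le {c β : ℝ} (hc : 0 < c) (hβ : 0 < β) :
    ∀ᶠ N : ℕ in atTop, Real.exp (-c * N) ≤ β := by
  have h : Tendsto (fun N : ℕ => Real.exp (-c * N)) atTop (nhds 0) := by
    refine Real.tendsto_exp_atBot.comp ?_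
    exact tendsto_natCast_atTop_atTop.const_mul_atTop_of_neg (by linarith)
  filter_upwards [h.eventually (gt_mem_nhds hβ)] with N hN using hN.le

theorem left_mem_interpolation (A A' : Tensor p N) : A ∈ interpolation A A' :=
  ⟨0, by simp, by simp⟩

theorem rotation_mem_interpolation (A A' : Tensor p N) {θ : ℝ} (h0 : 0 ≤ θ)
    (h1 : θ ≤ Real.pi / 2) : Real.cos θ • A + Real.sin θ • A' ∈ interpolation A A' := by
  refine ⟨Real.sin θ ^ 2, ⟨sq_nonneg _, Real.sin_sq_le_one θ⟩, ?_⟩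
  rw [← Real.cos_sq', Real.sqrt_sq (Real.cos_nonneg_of_neg_pi_div_two_le_of_le (by linarith) h1),
    Real.sqrt_sq (Real.sin_nonneg_of_nonneg_of_le_pi h0 (by linarith [Real.pi_pos]))]

/-- It suffices to exhibit one sample at which the gap property forces the solid-cube minimum below
`-μN`, rounding costs at most `μ/4`, and the ground state exceeds its mean minus `μ/4`. -/
theorem eventually_meanGroundState_le (hp : 0 < p) {μ ν₁ ν₂ c : ℝ} (hμ : 0 < μ) (hν₁ : 0 < ν₁)
    (hν : ν₁ < ν₂) (hν₂ : ν₂ < 1) (hc : 0 < c)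
    (h : ∀ᶠ N : ℕ in atTop,
      1 - Real.exp (-c * N) ≤ ((couplingLaw p N).prod (couplingLaw p N)).real
        {AA | OverlapGapProperty (interpolation AA.1 AA.2) (hilbertCube N) μ ν₁ ν₂}) :
    ∀ᶠ N : ℕ in atTop, meanGroundState p N ≤ -(μ / 2) := by
  filter_upwards [h, eventually_infOn_binaryCube_le hp (ε := μ / 4) (by positivity),
    eventually_exp_neg_mul_le hc (β := 1 / 8) (by norm_num),
    eventually_exp_neg_mul_le one_pos (β := 1 / 8) (by norm_num),
    eventually_exp_neg_mul_le (c := (μ / 4) ^ 2 / 4) (by positivity) (β := 1 / 8) (by norm_num),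
    eventually_ge_atTop 2] with N h hBH he₁ he₂ he₃ hN
  have hN0 : 0 < N := by omega
  have hN' : (0 : ℝ) < N := by exact_mod_cast hN0
  have hη := couplingLaw_groundState_le_le (p := p) hN0 hp (t := μ / 4) (by positivity)
  rw [← neg_mul] at hη
  rw [neg_one_mul] at he₂
  set S := {A : Tensor p N | ¬ infOn A (binaryCube N) ≤ infOn A (hilbertCube N) + μ / 4 * N} ∪
    {A | groundState A ≤ meanGroundState p N - μ / 4}
  have hS : couplingLaw p N S ≤ ENNReal.ofReal (3 / 8) := by
    refine (measure_union_le _ _).trans ((add_le_add hBH hη).trans ?_)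
    rw [← ENNReal.ofReal_add (by positivity) (by positivity)]
    exact ENNReal.ofReal_le_ofReal (by linarith)
  obtain ⟨AA, hAA, hAS⟩ := exists_mem_notMem_of_measure_le h
    ((couplingLaw_prod_rotation_le (a := 1) (b := 0) (by norm_num) S).trans hS) (by norm_num)
    (by linarith)
  have h1 := OverlapGapProperty.infOn_add_le hp hN hν₁ hν hν₂ hAA
    (left_mem_interpolation AA.1 AA.2)
  simp only [one_smul, zero_smul, add_zero, S, Set.mem_ofPred_eq, Set.mem_union, not_or,
    not_le] at hAS
  obtain ⟨h2, h3⟩ := hAS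
  have h4 : groundState AA.1 ≤ infOn AA.1 (hilbertCube N) / N + μ / 4 := by
    rw [groundState, div_le_iff₀ hN', add_mul, div_mul_cancel₀ _ hN'.ne']
    exact not_lt.1 h2
  linarith

/-- Replacing `B` by `A` costs `r` in the ground state, `r` in the value at a fixed point, and `s p
C r` through the move of the output. -/
theorem eval_div_le_of_injBound_sub (hN : 0 < N) {V : Tensor p N → Fin N → ℝ}
    (hV : ∀ A, V A ∈ hilbertCube N) {A B : Tensor p N} {s C r e : ℝ} (hs : 0 ≤ s) (hC : 0 ≤ C)
    (hr : 0 ≤ r) (hB : InjBound B s) (hAB : InjBound (A - B) r) (hVr : rms (V A - V B) ≤ C * r)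
    (he : (2 + s * p * C) * r ≤ e) (hopt : eval B (V B) / N ≤ groundState B + e) :
    eval A (V A) / N ≤ groundState A + 2 * e := by
  have hN' : (0 : ℝ) < N := by exact_mod_cast hN
  have h1 := form_sub_form_le_of_injBound hN hs hr hB hAB (x := fun _ => V A) (y := fun _ => V B)
    zero_le_one (D := C * r) (by positivity) (fun _ => rms_le_one_of_mem_hilbertCube (hV A))
    (fun _ => rms_le_one_of_mem_hilbertCube (hV B)) fun _ => hVr
  rw [← eval_eq_form, ← eval_eq_form, one_pow, one_pow] at h1
  have h2 : InjBound (B - A) r := by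
    simpa using hAB.smul (-1)
  have h3 := infOn_le_add binaryCube_subset_hilbertCube binaryCube_nonempty hr h2
  rw [groundState, ← sub_le_iff_le_add', ← sub_div, div_le_iff₀ hN'] at hopt
  rw [groundState, ← sub_le_iff_le_add', ← sub_div, div_le_iff₀ hN']
  have h4 := le_abs_self (eval A (V A) - eval B (V B))
  have h5 := mul_le_mul_of_nonneg_right he hN'.le
  nlinarith

/-- The deterministic core: all probabilistic input has become hypotheses on one pair `A`, `A'` and
the `m + 1` grid points of the quarter rotation between them. -/
theorem false_of_stable_near_optimizers (hN : 0 < N) (hp : 0 < p) {V : Tensor p N → Fin N → ℝ}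
    (hV : ∀ A, V A ∈ hilbertCube N) {s C : ℝ} (hs : 0 < s)
    (hstab : ∀ A B δ, 0 ≤ δ → InjBound B (2 * s) → InjBound (A - B) δ → rms (V A - V B) ≤ C * δ)
    {μ ν₁ ν₂ δ e c₀ g : ℝ} (hν₁ : 0 < ν₁) (hν : ν₁ < ν₂) (hν₂ : ν₂ < 1)
    (hδ : 0 ≤ δ) (hc₀ : 0 < c₀) (heμ : 3 * e ≤ μ) (heδ : 3 * e < δ * c₀) (hec : 3 * e ≤ c₀ / 2)
    (hg : g ≤ -c₀) {m : ℕ} (hm0 : 0 < m)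
    (hm : 2 * (C * (Real.pi * s / m)) < (ν₂ - ν₁) * (c₀ / (4 * s))) {A A' : Tensor p N}
    (hA : InjBound A s) (hA' : InjBound A' s)
    (hOGP : OverlapGapProperty (interpolation A A') (hilbertCube N) μ ν₁ ν₂)
    (horth : ∀ v₁ ∈ hilbertCube N, ∀ v₂ ∈ hilbertCube N, eval A v₁ / N < (1 - δ) * g →
      eval A' v₂ / N < (1 - δ) * g → |inner v₁ v₂| ≤ ν₁ * (c₀ / (4 * s)) ^ 2 * N)
    {R : ℕ → Tensor p N} (hR : R = fun j : ℕ => Real.cos (j * (Real.pi / (2 * m))) • A +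
      Real.sin (j * (Real.pi / (2 * m))) • A')
    (hBH : ∀ j ≤ m, infOn (R j) (binaryCube N) ≤ infOn (R j) (hilbertCube N) + e * N)
    (hη : ∀ j ≤ m, groundState (R j) < g + e)
    (hopt : ∀ j ≤ m, eval (R j) (V (R j)) / N ≤ groundState (R j) + 2 * e) : False := by
  have hN' : (0 : ℝ) < N := by exact_mod_cast hN
  have hm' : (0 : ℝ) < m := by exact_mod_cast hm0
  have hπ := Real.pi_pos
  have hlow : ∀ j ≤ m, eval (R j) (V (R j)) / N < g + 3 * e := fun j hj => by
    linarith [hη j hj, hopt j hj]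
  have hRb : ∀ j, InjBound (R j) (2 * s) := fun j => by
    rw [hR]
    refine ((hA.smul _).add (hA'.smul _)).mono ?_
    nlinarith [Real.abs_cos_le_one (j * (Real.pi / (2 * m))),
      Real.abs_sin_le_one (j * (Real.pi / (2 * m)))]
  have hstep : ∀ j, InjBound (R (j + 1) - R j) (Real.pi * s / m) := fun j => by
    set θ := (j : ℝ) * (Real.pi / (2 * m))
    set θ' := ((j + 1 : ℕ) : ℝ) * (Real.pi / (2 * m))
    have hθ : |θ' - θ| = Real.pi / (2 * m) := by
      have : θ' - θ = Real.pi / (2 * m) := by simp only [θ, θ']; push_cast; ring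
      rw [this, abs_of_pos (by positivity)]
    have e1 : R (j + 1) - R j =
        (Real.cos θ' - Real.cos θ) • A + (Real.sin θ' - Real.sin θ) • A' := by
      simp only [hR, sub_smul, θ, θ']
      abel
    rw [e1]
    refine ((hA.smul _).add (hA'.smul _)).mono ?_
    have h1 : |Real.cos θ' - Real.cos θ| ≤ Real.pi / (2 * m) := by
      rw [← hθ]; exact Real.abs_cos_sub_cos_le _ _
    have h2 : |Real.sin θ' - Real.sin θ| ≤ Real.pi / (2 * m) := by
      rw [← hθ]; exact Real.abs_sin_sub_sin_le _ _
    calc _ ≤ Real.pi / (2 * m) * s + Real.pi / (2 * m) * s := by gcongr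
      _ = _ := by field_simp; ring
  have hR0 : R 0 = A := by simp [hR]
  have hRm : R m = A' := by
    have : (m : ℝ) * (Real.pi / (2 * m)) = Real.pi / 2 := by field_simp
    simp [hR, this]
  refine hOGP.false_of_path hN (κ := c₀ / (4 * s)) (m := m) (A := R) (V := fun j => V (R j)) hν₁ hν₂
    (by positivity) hm (fun j hj => ?_) (fun j _ => hV _) (fun j hj => ?_) (fun j hj => ?_)
    (fun j _ => hstab _ _ _ (by positivity) (hRb j) (hstep j)) ?_ hν
  · have hj' : (j : ℝ) ≤ m := by exact_mod_cast hj
    rw [hR]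
    refine rotation_mem_interpolation A A' (by positivity) ?_
    calc (j : ℝ) * (Real.pi / (2 * m)) ≤ m * (Real.pi / (2 * m)) := by gcongr
      _ = _ := by field_simp
  · have h1 : groundState (R j) ≤ infOn (R j) (hilbertCube N) / N + e := by
      rw [groundState, div_le_iff₀ hN', add_mul, div_mul_cancel₀ _ hN'.ne']
      exact hBH j hj
    linarith [hopt j hj]
  -- The value is below `-(c₀/2) N` and the injective norm at most `2s`, so `c₀/2 ≤ 2s rms^p ≤ 2s
  -- rms`; this gives `κ = c₀/(4s)`.
  · have h1 := hRb j fun _ => V (R j)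
    rw [← eval_eq_form, Finset.prod_const, Finset.card_univ, Fintype.card_fin] at h1
    have h2 : rms (V (R j)) ^ p ≤ rms (V (R j)) :=
      pow_le_of_le_one (rms_nonneg _) (rms_le_one_of_mem_hilbertCube (hV _)) hp.ne'
    have h3 : eval (R j) (V (R j)) < -(c₀ / 2) * N := by
      rw [← div_lt_iff₀ hN']
      linarith [hlow j hj]
    have h4 : c₀ / 2 * N ≤ 2 * s * rms (V (R j)) * N := by
      calc c₀ / 2 * N ≤ |eval (R j) (V (R j))| := by linarith [neg_abs_le (eval (R j) (V (R j)))]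
        _ ≤ 2 * s * N * rms (V (R j)) ^ p := h1
        _ ≤ 2 * s * N * rms (V (R j)) := by gcongr
        _ = _ := by ring
    have h5 := le_of_mul_le_mul_right h4 hN'
    rw [div_le_iff₀ (by positivity)]
    linarith
  -- Since `g ≤ -c₀` and `3e < δ c₀`, the two endpoint outputs meet the threshold of part (ii).
  · have h1 : g + 3 * e ≤ (1 - δ) * g := by nlinarith
    refine horth _ (hV _) _ (hV _) ?_ ?_
    · have := hlow 0 (Nat.zero_le _)
      rw [hR0] at this ⊢
      exact this.trans_le h1
    · have := hlow m le_rfl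
      rw [hRm] at this ⊢
      exact this.trans_le h1

/-! ### Amplification of the success probability and conclusion -/

theorem couplingLaw_far_le (hN : 0 < N) (hp : 0 < p) {B : Set (Tensor p N)} {r c : ℝ}
    (hc : c ≤ r ^ 2 / 8) (hB : ENNReal.ofReal (Real.exp (-c * N) / 2) ≤ couplingLaw p N B) :
    couplingLaw p N {A | ∀ A' ∈ B, r ^ 2 * N ^ 2 / N ^ p ≤ ∑ i, (A i - A' i) ^ 2} ≤
      ENNReal.ofReal (2 * Real.exp (-(r ^ 2 / 8) * N)) := by
  have h := couplingLaw_far_mul_le hN hp B r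
  have hpos := Real.exp_pos (-c * N)
  refine (ENNReal.le_div_iff_mul_le (Or.inl ?_) (Or.inl ENNReal.ofReal_ne_top)).2
    ((mul_le_mul_right hB _).trans h) |>.trans ?_
  · simpa using hpos
  rw [← ENNReal.ofReal_div_of_pos (by positivity)]
  refine ENNReal.ofReal_le_ofReal ?_
  rw [div_le_iff₀ (by positivity)]
  have e : 2 * Real.exp (-(r ^ 2 / 8) * N) * (Real.exp (-c * N) / 2) =
      Real.exp (-(r ^ 2 / 8) * N + -c * N) := by rw [Real.exp_add]; ring
  rw [e]
  refine Real.exp_le_exp.2 ?_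
  have : c * N ≤ r ^ 2 / 8 * N := by gcongr
  nlinarith

/-- Success with probability at least `e^{-cN}/2` spreads: by isoperimetry a typical tensor lies
within injective distance `r` of a success, and stability then costs only a doubling of the error
`e`. -/
theorem couplingLaw_not_near_optimal_le (hN : 0 < N) (hp : 0 < p)
    {V : Tensor p N → Fin N → ℝ} (hV : ∀ A, V A ∈ hilbertCube N) {s C : ℝ} (hs : 0 < s)
    (hC : 0 ≤ C)
    (hstab : ∀ A B δ, 0 ≤ δ → InjBound B (2 * s) → InjBound (A - B) δ → rms (V A - V B) ≤ C * δ)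
    {r e c : ℝ} (hr : 0 < r) (he : (2 + 2 * s * p * C) * r ≤ e) (hc : c ≤ r ^ 2 / 8)
    (hB : ENNReal.ofReal (Real.exp (-c * N) / 2) ≤ couplingLaw p N
      {A | InjBound A s ∧ eval A (V A) / N ≤ groundState A + e}) :
    couplingLaw p N {A | ¬ eval A (V A) / N ≤ groundState A + 2 * e} ≤
      ENNReal.ofReal (2 * Real.exp (-(r ^ 2 / 8) * N)) := by
  refine (measure_mono fun A hA B hB => ?_).trans (couplingLaw_far_le hN hp hc hB)
  by_contra! hlt
  obtain ⟨hBs, hBopt⟩ := hB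
  have hBs' : InjBound B (2 * s) := hBs.mono (by linarith)
  have hAB : InjBound (A - B) r := injBound_of_sum_sq_le hN hr.le hlt.le
  exact hA (eval_div_le_of_injBound_sub hN hV (by positivity) hC hr.le hBs' hAB
    (hstab A B r hr.le hBs' hAB) he hBopt)

theorem false_of_couplingLaw_near_optimal_ge (hN : 0 < N) (hp : 0 < p)
    {V : Tensor p N → Fin N → ℝ} (hV : ∀ A, V A ∈ hilbertCube N) {s C : ℝ} (hs : 0 < s)
    (hC : 0 ≤ C)
    (hstab : ∀ A B δ, 0 ≤ δ → InjBound B (2 * s) → InjBound (A - B) δ → rms (V A - V B) ≤ C * δ)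
    {μ ν₁ ν₂ δ e c₀ : ℝ} (hν₁ : 0 < ν₁) (hν : ν₁ < ν₂) (hν₂ : ν₂ < 1)
    (hδ : 0 ≤ δ) (hc₀ : 0 < c₀) (he0 : 0 ≤ e) (heμ : 3 * e ≤ μ) (heδ : 3 * e < δ * c₀)
    (hec : 3 * e ≤ c₀ / 2) (hg : meanGroundState p N ≤ -c₀) {m : ℕ} (hm0 : 0 < m)
    (hm : 2 * (C * (Real.pi * s / m)) < (ν₂ - ν₁) * (c₀ / (4 * s)))
    {r c : ℝ} (hr : 0 < r) (he : (2 + 2 * s * p * C) * r ≤ e) (hc : c ≤ r ^ 2 / 8)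
    (hB : ENNReal.ofReal (Real.exp (-c * N) / 2) ≤ couplingLaw p N
      {A | InjBound A s ∧ eval A (V A) / N ≤ groundState A + e})
    {β c₁ c₂ : ℝ} (hβ0 : 0 < β) (hβ : (10 * (m + 2)) * β ≤ 1)
    (hOGP : 1 - Real.exp (-c₁ * N) ≤ ((couplingLaw p N).prod (couplingLaw p N)).real
      {AA | OverlapGapProperty (interpolation AA.1 AA.2) (hilbertCube N) μ ν₁ ν₂})
    (hβ₁ : Real.exp (-c₁ * N) ≤ β)
    (horth : 1 - Real.exp (-c₂ * N) ≤ ((couplingLaw p N).prod (couplingLaw p N)).real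
      {AA | ∀ v₁ ∈ hilbertCube N, ∀ v₂ ∈ hilbertCube N,
        eval AA.1 v₁ / N ≤ (1 - δ) * meanGroundState p N →
        eval AA.2 v₂ / N ≤ (1 - δ) * meanGroundState p N →
          |inner v₁ v₂| ≤ ν₁ * (c₀ / (4 * s)) ^ 2 * N})
    (hβ₂ : Real.exp (-c₂ * N) ≤ β)
    (hK : couplingLaw p N {A | ¬ InjBound A s} ≤ ENNReal.ofReal (Real.exp (-N)))
    (hβ₃ : Real.exp (-N) ≤ β)
    (hBH : couplingLaw p N
      {A | ¬ infOn A (binaryCube N) ≤ infOn A (hilbertCube N) + e * N} ≤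
        ENNReal.ofReal (2 * Real.exp (-N)))
    (hβ₄ : Real.exp (-(e ^ 2 / 4) * N) ≤ β) (hβ₅ : Real.exp (-(r ^ 2 / 8) * N) ≤ β) : False := by
  have hfar := couplingLaw_not_near_optimal_le hN hp hV hs hC hstab hr he hc hB
  have hη := couplingLaw_groundState_ge_le hN hp he0
  rw [← neg_mul] at hη
  have horth' := couplingLaw_prod_compl_overlap_le horth
  set S : Set (Tensor p N) := {A | ¬ eval A (V A) / N ≤ groundState A + 2 * e} ∪
    ({A | ¬ infOn A (binaryCube N) ≤ infOn A (hilbertCube N) + e * N} ∪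
      {A | meanGroundState p N + e ≤ groundState A}) with hS
  -- At each grid point: `2β` for near optimality, `2β` for rounding, `β` for the ground state.
  have hSle : couplingLaw p N S ≤ ENNReal.ofReal (5 * β) := by
    refine (measure_union_le _ _).trans ((add_le_add hfar ((measure_union_le _ _).trans
      (add_le_add hBH hη))).trans ?_)
    rw [← ENNReal.ofReal_add (by positivity) (by positivity),
      ← ENNReal.ofReal_add (by positivity) (by positivity)]
    exact ENNReal.ofReal_le_ofReal (by linarith)
  set θ : ℕ → ℝ := fun j => j * (Real.pi / (2 * m)) with hθ
  set E : Set (Tensor p N × Tensor p N) := {AA | ∀ v₁ ∈ hilbertCube N, ∀ v₂ ∈ hilbertCube N,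
        eval AA.1 v₁ / N < (1 - δ) * meanGroundState p N →
        eval AA.2 v₂ / N < (1 - δ) * meanGroundState p N →
          |inner v₁ v₂| ≤ ν₁ * (c₀ / (4 * s)) ^ 2 * N} with hE
  set G : Set (Tensor p N × Tensor p N) := Eᶜ ∪
    ({AA | (1 : ℝ) • AA.1 + (0 : ℝ) • AA.2 ∈ {A : Tensor p N | ¬ InjBound A s}} ∪
      ({AA | (0 : ℝ) • AA.1 + (1 : ℝ) • AA.2 ∈ {A : Tensor p N | ¬ InjBound A s}} ∪
        ⋃ j ∈ Finset.range (m + 1), {AA | Real.cos (θ j) • AA.1 + Real.sin (θ j) • AA.2 ∈ S}))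
    with hG
  have hGle : ((couplingLaw p N).prod (couplingLaw p N)) G ≤
      ENNReal.ofReal (β + (β + (β + (m + 1) * (5 * β)))) := by
    have hK' := hK.trans (ENNReal.ofReal_le_ofReal hβ₃)
    rw [ENNReal.ofReal_add (by positivity) (by positivity),
      ENNReal.ofReal_add (by positivity) (by positivity),
      ENNReal.ofReal_add (by positivity) (by positivity)]
    refine (measure_union_le _ _).trans (add_le_add
      (horth'.trans (ENNReal.ofReal_le_ofReal hβ₂)) ?_)
    refine (measure_union_le _ _).trans (add_le_add
      ((couplingLaw_prod_rotation_le (by norm_num) _).trans hK') ?_)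
    refine (measure_union_le _ _).trans (add_le_add
      ((couplingLaw_prod_rotation_le (by norm_num) _).trans hK') ?_)
    refine (measure_biUnion_finset_le _ _).trans ((Finset.sum_le_sum fun j _ =>
      (couplingLaw_prod_rotation_le (Real.cos_sq_add_sin_sq (θ j)) S).trans hSle).trans ?_)
    rw [Finset.sum_const, Finset.card_range, nsmul_eq_mul, ← ENNReal.ofReal_natCast,
      ← ENNReal.ofReal_mul (by positivity)]
    push_cast
    exact le_rfl
  obtain ⟨⟨A, A'⟩, hAA, hAG⟩ := exists_mem_notMem_of_measure_le hOGP hGle (by positivity)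
    (by nlinarith)
  simp only [hG, Set.mem_union, not_or, Set.mem_compl_iff, not_not, Set.mem_ofPred_eq, one_smul,
    zero_smul, add_zero, zero_add, Set.mem_iUnion, not_exists, Finset.mem_range] at hAG
  obtain ⟨hAE, hA, hA', hj⟩ := hAG
  refine false_of_stable_near_optimizers hN hp hV hs hstab hν₁ hν hν₂ hδ hc₀ heμ heδ hec hg hm0 hm
    hA hA' hAA hAE rfl (fun j hjm => ?_) (fun j hjm => ?_) fun j hjm => ?_
  all_goals
    have h1 := hj j (by omega)
    simp only [hS, Set.mem_union, not_or, Set.mem_ofPred_eq, not_le] at h1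
  · exact not_lt.1 h1.2.1
  · exact h1.2.2
  · exact not_lt.1 h1.1

/-- The start is fixed here, but all constants and the threshold on `N` are chosen before it; this
uniformity permits an arbitrary law of `U0`. -/
theorem OGPConjecture.exists_gap (hp : 0 < p) (h : OGPConjecture p) (M ζ : ℝ) (hM : 1 ≤ M)
    (hζ : 0 < ζ) (T : ℕ) (f : (t : ℕ) → (Fin t → ℝ) → ℝ) (F : (t : ℕ) → ℝ → (Fin t → ℝ) → ℝ)
    (hfF : AMPAssumption M ζ T f F) :
    ∃ e : ℝ, 0 < e ∧ ∃ c : ℝ, 0 < c ∧ ∀ᶠ N : ℕ in atTop, ∀ U0 ∈ box M N,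
      couplingLaw p N {A | ¬ infOn A (binaryCube N) / N + e ≤
        eval A (ampOutput M f F T A U0) / N} ≤ ENNReal.ofReal (Real.exp (-c * N)) := by
  obtain ⟨⟨μ, ν₁, ν₂, hμ, hν₁, hν, hν₂, c₁, hc₁, hOGP⟩, h₂⟩ := h
  obtain ⟨s, hs1, hs⟩ := exists_couplingLaw_not_injBound_le hp
  have hs0 : 0 < s := by linarith
  -- Stability is needed at injective norm `2s`, because `cos θ A + sin θ A'` inherits only this
  -- bound.
  obtain ⟨C, hC, hstab⟩ := exists_rms_ampOutput_sub_le p hp (by linarith) hζ.le hfF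
    (s := 2 * s) (by positivity)
  obtain ⟨c₀, hc₀⟩ : ∃ c₀ : ℝ, c₀ = μ / 2 := ⟨_, rfl⟩
  have hc₀0 : 0 < c₀ := by linarith
  obtain ⟨δ, hδ, c₂, hc₂, horth⟩ := h₂ (ν₁ * (c₀ / (4 * s)) ^ 2) (by positivity)
  obtain ⟨e, he⟩ : ∃ e : ℝ, e = min μ (min (δ * c₀) c₀) / 8 := ⟨_, rfl⟩
  have hmin : 0 < min μ (min (δ * c₀) c₀) := lt_min hμ (lt_min (by positivity) hc₀0)
  have he0 : 0 < e := by rw [he]; positivity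
  have he1 : 8 * e ≤ μ := by rw [he]; linarith [min_le_left μ (min (δ * c₀) c₀)]
  have he2 : 8 * e ≤ δ * c₀ := by
    rw [he]; linarith [min_le_right μ (min (δ * c₀) c₀), min_le_left (δ * c₀) c₀]
  have he3 : 8 * e ≤ c₀ := by
    rw [he]; linarith [min_le_right μ (min (δ * c₀) c₀), min_le_right (δ * c₀) c₀]
  have hden : 0 < 2 + 2 * s * p * C := by positivity
  obtain ⟨r, hr⟩ : ∃ r : ℝ, r = e / (2 + 2 * s * p * C) := ⟨_, rfl⟩
  have hr0 : 0 < r := by rw [hr]; positivity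
  have hre : (2 + 2 * s * p * C) * r ≤ e := by rw [hr, mul_div_cancel₀ _ hden.ne']
  have hgap : 0 < (ν₂ - ν₁) * (c₀ / (4 * s)) := mul_pos (by linarith) (by positivity)
  obtain ⟨m, hm⟩ := exists_nat_gt (2 * C * (Real.pi * s) / ((ν₂ - ν₁) * (c₀ / (4 * s))))
  have hπ := Real.pi_pos
  have hm0' : (0 : ℝ) < m := lt_of_le_of_lt (by positivity) hm
  have hm0 : 0 < m := by exact_mod_cast hm0'
  have hm' : 2 * (C * (Real.pi * s / m)) < (ν₂ - ν₁) * (c₀ / (4 * s)) := by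
    rw [div_lt_iff₀ hgap] at hm
    rw [← mul_div_assoc, ← mul_div_assoc, div_lt_iff₀ hm0']
    linarith
  obtain ⟨β, hβ⟩ : ∃ β : ℝ, β = 1 / (10 * (m + 2)) := ⟨_, rfl⟩
  have hβ0 : 0 < β := by rw [hβ]; positivity
  have hβ1 : (10 * (m + 2)) * β ≤ 1 := by
    rw [hβ, mul_one_div, div_self (by positivity)]
  -- `r²/8` is what amplification tolerates; `1/2` lets half of `e^{-cN}` absorb the failure
  -- `e^{-N}` of the injective norm bound.
  obtain ⟨c, hc⟩ : ∃ c : ℝ, c = min (1 / 2) (r ^ 2 / 8) := ⟨_, rfl⟩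
  have hc0 : 0 < c := by rw [hc]; exact lt_min (by norm_num) (by positivity)
  refine ⟨e, he0, c, hc0, ?_⟩
  filter_upwards [hOGP, horth, eventually_infOn_binaryCube_le hp he0,
    eventually_meanGroundState_le hp hμ hν₁ hν hν₂ hc₁ hOGP,
    eventually_exp_neg_mul_le hc₁ hβ0, eventually_exp_neg_mul_le hc₂ hβ0,
    eventually_exp_neg_mul_le one_pos hβ0,
    eventually_exp_neg_mul_le (c := e ^ 2 / 4) (by positivity) hβ0,
    eventually_exp_neg_mul_le (c := r ^ 2 / 8) (by positivity) hβ0,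
    eventually_exp_neg_mul_le (c := 1 / 2) (β := 1 / 2) (by norm_num) (by norm_num),
    eventually_gt_atTop 0] with N hOGP horth hBH hg hβ₁ hβ₂ hβ₃ hβ₄ hβ₅ hhalf hN U0 hU0
  have hK := hs N hN
  rw [neg_one_mul] at hβ₃
  set bad : Set (Tensor p N) := {A | InjBound A s ∧
    eval A (ampOutput M f F T A U0) / N ≤ groundState A + e}
  have hbad : couplingLaw p N bad < ENNReal.ofReal (Real.exp (-c * N) / 2) := by
    by_contra! hB
    exact false_of_couplingLaw_near_optimal_ge hN hp
      (V := fun A => ampOutput M f F T A U0) (fun A => ampOutput_mem_hilbertCube A U0) hs0 hC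
      (fun A B d hd hB hAB => hstab N hN A B d hd hB hAB U0 hU0) hν₁ hν hν₂ hδ.le hc₀0 he0.le
      (by linarith) (by linarith) (by linarith) (by linarith) hm0 hm' hr0 hre
      (hc.trans_le (min_le_right _ _)) hB hβ0 hβ1 hOGP hβ₁ horth hβ₂ hK hβ₃ hBH hβ₄ hβ₅
  have hK' : Real.exp (-N) ≤ Real.exp (-c * N) / 2 := by
    have h1 : c ≤ 1 / 2 := hc.trans_le (min_le_left _ _)
    have h2 : Real.exp (-(N : ℝ)) = Real.exp (-(1 / 2) * N) * Real.exp (-(1 / 2) * N) := by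
      rw [← Real.exp_add]; congr 1; ring
    have h3 : Real.exp (-(1 / 2) * N) ≤ Real.exp (-c * N) :=
      Real.exp_le_exp.2 (by nlinarith [(Nat.cast_nonneg N : (0 : ℝ) ≤ N)])
    rw [h2]
    exact (mul_le_mul h3 hhalf (Real.exp_pos _).le (Real.exp_pos _).le).trans_eq (by ring)
  have hsub : {A : Tensor p N | ¬ infOn A (binaryCube N) / N + e ≤
      eval A (ampOutput M f F T A U0) / N} ⊆ bad ∪ {A | ¬ InjBound A s} := by
    intro A hA
    by_cases hAs : InjBound A s
    · exact Or.inl ⟨hAs, (not_le.1 hA).le⟩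
    · exact Or.inr hAs
  refine (measure_mono hsub).trans ((measure_union_le _ _).trans
    ((add_le_add hbad.le (hK.trans (ENNReal.ofReal_le_ofReal hK'))).trans ?_))
  rw [← ENNReal.ofReal_add (by positivity) (by positivity), add_halves]

end PSpin


theorem mainTheorem1 (p : ℕ) (hp : 4 ≤ p) (hpe : Even p)
    (M ζ : ℝ) (hM : 1 ≤ M) (hζ : 0 < ζ) (T : ℕ) (hT : 1 ≤ T)
    (f : (t : ℕ) → (Fin t → ℝ) → ℝ) (F : (t : ℕ) → ℝ → (Fin t → ℝ) → ℝ)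
    (hfF : PSpin.AMPAssumption M ζ T f F)
    (hOGP : PSpin.OGPConjecture p) :
    ∃ μbar : ℝ, 0 < μbar ∧ ∃ c : ℝ, 0 < c ∧ ∃ N₀ : ℕ, ∀ N : ℕ, N₀ ≤ N →
      ∀ (ν : MeasureTheory.Measure (Fin N → ℝ)) [MeasureTheory.IsProbabilityMeasure ν],
        (∀ᵐ U0 ∂ν, U0 ∈ PSpin.box M N) →
        1 - Real.exp (-c * N) ≤ ((PSpin.couplingLaw p N).prod ν).real
          {x | PSpin.infOn x.1 (PSpin.binaryCube N) / N + μbar ≤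
            PSpin.eval x.1 (PSpin.ampOutput M f F T x.1 x.2) / N} := by
  obtain ⟨e, he, c, hc, h⟩ := hOGP.exists_gap (by omega) M ζ hM hζ T f F hfF
  obtain ⟨N₀, hN₀⟩ := eventually_atTop.1 h
  refine ⟨e, he, c, hc, N₀, fun N hN ν _ hν => ?_⟩
  refine PSpin.one_sub_le_prod_real (Real.exp_pos _).le ?_
  filter_upwards [hν] with U0 hU0 using hN₀ N hN U0 hU0
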